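/- Let $K$ be an algebraically closed field of characteristic $p\ge 0$, and let $G$ be an affine algebraic group over $K$ (identified with its group of $K$-points) whose identity component $G^0$ is an algebraic torus and such that $G=Z_G(G^0)$, i.e. $G^0$ is central in $G$. Let $R$ be a commutative $K$-algebra that is a Krull domain, on which $G$ acts rationally by $K$-algebra automorphisms, and suppose that the kernel of $G\to\mathrm{Aut}(R)$ is finite. For a subgroup $S\le G$ let $R^S$ denote the ring of $S$-invariants. The group $G$ acts on $R^{G^0}$; for $S\le G$ write $S|_{R^{G^0}}$ for the image of $S$ in the group of automorphisms of $R^{G^0}$. Let $\mathfrak q$ be a prime ideal of height one of $R^{G^0}$, and let $$I=\mathcal I_G(\mathfrak q)=\{\sigma\in G\mid \sigma(x)-x\in\mathfrak q\ \text{for all }x\in R^{G^0}\}$$ be its inertia group. Let $U$ be the subgroup of $G$ generated by the elements of $I$ that are unipotent in $G$. If $p>0$, let $I_{[p]}$ be the inverse image in $I$ of a Sylow $p$-subgroup of $I|_{R^{G^0}}$; if $p=0$, let $I_{[0]}$ be the kernel of $I\to I|_{R^{G^0}}$. Then: (i) $U$ is a finite group and, for every choice of the Sylow $p$-subgroup,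 $$U|_{R^{G^0}}=I_{[p]}|_{R^{G^0}}\qquad\text{and}\qquad R^{U\cdot G^0}=R^{I_{[p]}}.$$ (ii) There is a diagonalizable closed subgroup $D$ of $G$ with $G^0\subseteq D\subseteq I$ such that $D/G^0$ is cyclic and $R^{U\cdot D}=R^{I}$. (iii) The canonical homomorphism of local rings $$R^G_{\mathfrak q\cap R^G}\longrightarrow R^{I}_{\mathfrak q\cap R^{I}}$$ is étale, i.e. the target is the localization at a prime ideal of an étale algebra over the source. Moreover, put $B=R^{U\cdot G^0}$ and $\mathfrak Q=\mathfrak q\cap B$. Then $\mathfrak Q$ and $\mathfrak q\cap R^G$ have height one, and the ramification index $e=\mathrm e(\mathfrak Q,\mathfrak q\cap R^G)$, for which $(\mathfrak q\cap R^G)B_{\mathfrak Q}=(\mathfrak QB_{\mathfrak Q})^{e}$, is not divisible by $p$ if $p>0$. -/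

import Mathlib

/-- The structure of an affine algebraic group over an algebraically closed field `K` on an abstract
group `G`: the finitely generated `K`-algebra of regular functions on `G`, whose `K`-algebra
homomorphisms to `K` are exactly the evaluations at the points of `G`, and for which multiplication
`G × G → G` and inversion `G → G` are morphisms. -/
structure AffineAlgebraicGroup (K G : Type*) [Field K] [Group G] where
  /-- the coordinate ring `K[G]`, an algebra of functions on `G` -/
  regular : Subalgebra K (G → K)
  finitelyGenerated : regular.FG
  eval_bijective : Function.Bijective
    fun g : G => (Pi.evalAlgHom K (fun _ : G => K) g).comp regular.val
  mul_regular : ∀ f ∈ regular, ∃ (n : ℕ) (a b : Fin n → G → K),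
    (∀ i, a i ∈ regular) ∧ (∀ i, b i ∈ regular) ∧ ∀ x y, f (x * y) = ∑ i, a i x * b i y
  inv_regular : ∀ f ∈ regular, (fun x => f x⁻¹) ∈ regular

namespace AffineAlgebraicGroup

variable {K G : Type*} [Field K] [Group G] (V : AffineAlgebraicGroup K G)

/-- The Zariski topology on `G`. -/
@[reducible]
def zariski : TopologicalSpace G :=
  TopologicalSpace.generateFrom {U | ∃ f ∈ V.regular, U = {g | f g ≠ 0}}

theorem regular_mul_left {f : G → K} (hf : f ∈ V.regular) (g : G) :
    (fun x => f (g * x)) ∈ V.regular := by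
  obtain ⟨n, a, b, -, hb, h⟩ := V.mul_regular f hf
  have : (fun x => f (g * x)) = ∑ i, a i g • b i := by
    funext x
    simp [h, Finset.sum_apply]
  rw [this]
  exact Subalgebra.sum_mem _ fun i _ => Subalgebra.smul_mem _ (hb i) _

theorem regular_mul_right {f : G → K} (hf : f ∈ V.regular) (g : G) :
    (fun x => f (x * g)) ∈ V.regular := by
  obtain ⟨n, a, b, ha, -, h⟩ := V.mul_regular f hf
  have : (fun x => f (x * g)) = ∑ i, b i g • a i := by
    funext x
    simp [h, Finset.sum_apply, mul_comm]
  rw [this]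
  exact Subalgebra.sum_mem _ fun i _ => Subalgebra.smul_mem _ (ha i) _

theorem continuous_of_regular (φ : G → G)
    (h : ∀ f ∈ V.regular, (fun x => f (φ x)) ∈ V.regular) :
    @Continuous G G V.zariski V.zariski φ := by
  let := V.zariski
  refine continuous_generateFrom_iff.2 ?_
  rintro _ ⟨f, hf, rfl⟩
  exact TopologicalSpace.isOpen_generateFrom_of_mem ⟨_, h f hf, rfl⟩

theorem image_connectedComponent (φ : G → G)
    (h : ∀ f ∈ V.regular, (fun x => f (φ x)) ∈ V.regular) {x y : G}
    (hx : x ∈ @connectedComponent G V.zariski 1)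
    (hy : φ y ∈ @connectedComponent G V.zariski 1)
    (hy1 : y ∈ @connectedComponent G V.zariski 1) :
    φ x ∈ @connectedComponent G V.zariski 1 := by
  let := V.zariski
  have hc : IsPreconnected (φ '' connectedComponent (1 : G)) :=
    isPreconnected_connectedComponent.image φ (V.continuous_of_regular φ h).continuousOn
  have hsub := hc.subset_connectedComponent (Set.mem_image_of_mem φ hy1)
  rw [← connectedComponent_eq hy] at hsub
  exact hsub (Set.mem_image_of_mem φ hx)

/-- The identity component `G⁰`: the connected component of `1` in the Zariski topology. -/
def identityComponent : Subgroup G where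
  carrier := @connectedComponent G V.zariski 1
  one_mem' := @mem_connectedComponent G V.zariski 1
  mul_mem' := by
    intro a b ha hb
    exact V.image_connectedComponent (a * ·) (fun f hf => V.regular_mul_left hf a) hb
      (y := 1) (by simpa using ha) (@mem_connectedComponent G V.zariski 1)
  inv_mem' := by
    intro a ha
    exact V.image_connectedComponent (·⁻¹) (fun f hf => V.inv_regular f hf) ha
      (y := 1) (by simpa using @mem_connectedComponent G V.zariski 1)
      (@mem_connectedComponent G V.zariski 1)

instance identityComponent_normal : V.identityComponent.Normal where
  conj_mem := by
    intro n hn g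
    exact V.image_connectedComponent (fun x => g * x * g⁻¹)
      (fun f hf => V.regular_mul_left (V.regular_mul_right hf g⁻¹) g) hn
      (y := 1) (by simpa using @mem_connectedComponent G V.zariski 1)
      (@mem_connectedComponent G V.zariski 1)

/-- A subgroup is closed if it is closed in the Zariski topology. -/
def IsClosedSubgroup (S : Subgroup G) : Prop :=
  @IsClosed G V.zariski (S : Set G)

/-- The algebra of functions on a (closed) subgroup `S` that are restrictions of regular functions
on `G`; for closed `S` this is the coordinate ring `K[S]`. -/
def regularOn (S : Subgroup G) : Subalgebra K (S → K) :=
  V.regular.map (AlgHom.ofLinearMap (LinearMap.funLeft K K ((↑) : S → G)) rfl fun _ _ => rfl)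

/-- The closed subgroup `T` is an algebraic torus: it is isomorphic, as an algebraic group, to
`(Kˣ)ʳ`, whose regular functions are the Laurent polynomials in the coordinates. -/
def IsTorus (T : Subgroup G) : Prop :=
  V.IsClosedSubgroup T ∧ ∃ (r : ℕ) (φ : T ≃* (Fin r → Kˣ)),
    V.regularOn T = Algebra.adjoin K
      (Set.range (fun (i : Fin r) (t : T) => ((φ t i : Kˣ) : K)) ∪
        Set.range (fun (i : Fin r) (t : T) => (((φ t i)⁻¹ : Kˣ) : K)))

/-- The closed subgroup `D` is diagonalizable: `K[D]` is spanned over `K` by the rational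
characters of `D`. -/
def IsDiagonalizable (D : Subgroup G) : Prop :=
  V.IsClosedSubgroup D ∧ ∀ f ∈ V.regularOn D,
    f ∈ Submodule.span K {χ : D → K | χ ∈ V.regularOn D ∧ ∃ ψ : D →* K, χ = ψ}

/-- `σ` is unipotent: right translation by `σ` acts locally unipotently on `K[G]`. -/
def IsUnipotent (σ : G) : Prop :=
  ∀ f ∈ V.regular, ∃ n : ℕ, ((LinearMap.funLeft K K (fun x : G => x * σ) - 1) ^ n) f = 0

/-- The action of `G` on `M` is rational: every `m` lies in a finite-dimensional subspace in which
the coordinates of `σ • m` are regular functions of `σ`. -/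
def IsRational (M : Type*) [AddCommGroup M] [Module K M] [SMul G M] : Prop :=
  ∀ m : M, ∃ (n : ℕ) (a : Fin n → G → K) (v : Fin n → M),
    (∀ i, a i ∈ V.regular) ∧ ∀ σ : G, σ • m = ∑ i, a i σ • v i

end AffineAlgebraicGroup

/-- Krull domains: every localization at a height-one prime is a discrete valuation ring, the
domain is the intersection of these localizations in its field of fractions, and each nonzero
element lies in only finitely many height-one primes. -/
structure IsKrullDomain (R : Type*) [CommRing R] : Prop extends IsDomain R where
  localization_isDVR : ∀ (P : Ideal R) [P.IsPrime], P.height = 1 →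
    ∃ _ : IsDomain (Localization.AtPrime P), IsDiscreteValuationRing (Localization.AtPrime P)
  mem_of_mem_localizations : ∀ x : FractionRing R,
    (∀ P : Ideal R, P.IsPrime → P.height = 1 → ∃ a s : R, s ∉ P ∧
      x * algebraMap R (FractionRing R) s = algebraMap R (FractionRing R) a) →
    ∃ a : R, algebraMap R (FractionRing R) a = x
  finite_height_one : ∀ a : R, a ≠ 0 →
    {P : Ideal R | P.IsPrime ∧ P.height = 1 ∧ a ∈ P}.Finite

/-- A homomorphism `A → B` of local rings is étale: `B` is, over `A`, the localization of an étale
`A`-algebra at a prime ideal. -/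
def IsEtaleLocalHom.{u} {A B : Type u} [CommRing A] [CommRing B] (f : A →+* B) : Prop :=
  ∃ (C : Type u) (_ : CommRing C) (_ : Algebra A C) (n : Ideal C) (_ : n.IsPrime)
    (e : Localization.AtPrime n ≃+* B),
    Algebra.Etale A C ∧ ∀ a, e (algebraMap C (Localization.AtPrime n) (algebraMap A C a)) = f a

/-- The ramification index `e(Q, Q ∩ A)` of a prime `Q` of `B` along `f : A → B`: the length of
`B_Q / (Q ∩ A) B_Q`, which is the valuation of `(Q ∩ A) B_Q` when `B_Q` is a discrete valuation
ring. -/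
noncomputable def ramificationIndex {A B : Type*} [CommRing A] [CommRing B] (f : A →+* B)
    (Q : Ideal B) : ℕ :=
  letI := f.toAlgebra
  Q.ramificationIdx A

section Invariants

variable (K : Type*) [Field K] {G : Type*} [Group G] (R : Type*) [CommRing R] [Algebra K R]
  [MulSemiringAction G R] [SMulCommClass G K R]

/-- The ring of invariants `R^S` of a subgroup `S` of `G`. -/
abbrev invariants (S : Subgroup G) : Subalgebra K R :=
  FixedPoints.subalgebra K R S

theorem invariants_anti {S T : Subgroup G} (h : S ≤ T) : invariants K R T ≤ invariants K R S :=
  fun _ hx g => hx ⟨g.1, h g.2⟩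

/-- The inclusion `R^T → R^S` for `S ≤ T`. -/
abbrev invariantsInclusion {S T : Subgroup G} (h : S ≤ T) :
    invariants K R T →+* invariants K R S :=
  (Subalgebra.inclusion (invariants_anti K R h)).toRingHom

/-- The action of `G` on `R^N` for a normal subgroup `N` of `G`, as a homomorphism to the group of
permutations of `R^N`. The image of `S ≤ G` under it is `S|_{R^N}`. -/
def restrictionHom (N : Subgroup G) [N.Normal] : G →* Equiv.Perm (invariants K R N) :=
  (MulAction.toPermHom (G ⧸ N) (invariants K R N)).comp (QuotientGroup.mk' N)

theorem restrictionHom_apply (N : Subgroup G) [N.Normal] (σ : G) (x : invariants K R N) :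
    (restrictionHom K R N σ x : R) = σ • (x : R) :=
  rfl

variable {K R}

/-- The inertia group `I_G(q)` of an ideal `q` of `R^N`, where `N` is a normal subgroup of `G`. -/
def inertiaGroup {N : Subgroup G} [N.Normal] (q : Ideal (invariants K R N)) : Subgroup G :=
  (q.inertia (G ⧸ N)).comap (QuotientGroup.mk' N)

theorem mem_inertiaGroup {N : Subgroup G} [N.Normal] (q : Ideal (invariants K R N)) (σ : G) :
    σ ∈ inertiaGroup q ↔ ∀ x : invariants K R N, restrictionHom K R N σ x - x ∈ q :=
  Iff.rfl

theorem le_inertiaGroup {N : Subgroup G} [N.Normal] (q : Ideal (invariants K R N)) :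
    N ≤ inertiaGroup q := by
  intro σ hσ
  rw [mem_inertiaGroup]
  intro x
  have : restrictionHom K R N σ x = x := Subtype.ext (x.2 ⟨σ, hσ⟩)
  simp [this]

/-- `J` is a group `I_G(q)_[p]`: the inverse image in `I_G(q)` of a Sylow `p`-subgroup of
`I_G(q)|_{R^N}` if `p ≠ 0`, and the kernel of `I_G(q) → I_G(q)|_{R^N}` if `p = 0`. -/
def IsInertiaPPart {N : Subgroup G} [N.Normal] (p : ℕ) (q : Ideal (invariants K R N))
    (J : Subgroup G) : Prop :=
  (p = 0 ∧ J = inertiaGroup q ⊓ (restrictionHom K R N).ker) ∨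
    (p ≠ 0 ∧ ∃ P : Sylow p ((inertiaGroup q).map (restrictionHom K R N)),
      J = inertiaGroup q ⊓
        ((P : Subgroup ((inertiaGroup q).map (restrictionHom K R N))).map
          (Subgroup.subtype _)).comap (restrictionHom K R N))

end Invariants

/-- `⟨Unip(S)⟩`: the subgroup generated by the elements of `S` which are unipotent in `G`. -/
def AffineAlgebraicGroup.unipotentClosure {K G : Type*} [Field K] [Group G]
    (V : AffineAlgebraicGroup K G) (S : Subgroup G) : Subgroup G :=
  Subgroup.closure {σ | σ ∈ S ∧ V.IsUnipotent σ}

/-! Write T for the identity component and A for the ring of T-invariants. Since T has finite index,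
the finite group Γ = G/T acts on A, and for S containing T the S-invariants are the fixed ring in A
of the image of S. Moreover A = R ∩ Frac A inside the Krull domain R, which makes the local ring of
A at q a discrete valuation ring (`IsKrullDomain.isDiscreteValuationRing_of_saturated`). What
remains is ramification theory for a finite group, together with the group theory of a central
torus.

Ramification is governed by the tame character χ from I to the units of the residue field of q,
which records how σ scales a uniformizer (`exists_tame_character`). An element of ker χ whose action
on A has finite order prime to the characteristic acts trivially (`smul_eq_of_pow_smul_eq`). So ker
χ acts through a p-group. As fields of characteristic p have no p-torsion units, ker χ is the full
preimage of the unique Sylow p-subgroup, that is, the group I_[p]; in characteristic 0 it acts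
trivially.

Because T is a central torus, it is divisible and has no nontrivial unipotents. An element of
p-power order modulo T can therefore be corrected by T to one of p-power order, which is unipotent;
conversely unipotents have p-power order and are killed by χ. Hence U and ker χ have the same image
on A (`AffineAlgebraicGroup.map_unipotentClosure_eq`), and a transfer argument shows that U is
finite. The quotient I/ker χ is cyclic of order prime to p. A lift σ of a generator can be chosen so
that, together with T, it generates the diagonalizable group D.

For étaleness, an x fixed by I and moved modulo q by all of Γ outside I has a polynomial over the
Γ-invariants whose derivative at x is not in q. Lagrange interpolation then exhibits a standard
étale presentation (`exists_etale_away`). Étale maps do not change ramification, so e is computed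
over the I-invariants. There the product of the first n σ-translates of a uniformizer of B has order
n, with n prime to p, and e divides n. -/

/-! ### Étaleness over the invariants of a finite group. -/

open Polynomial in
/-- In a domain over an infinite field with an action of a finite group, some element fixed by the
inertia group of a prime `q` is moved modulo `q` by every element outside the inertia group. -/
theorem exists_fixed_smul_sub_notMem (k : Type*) {A Γ : Type*} [Field k] [Infinite k] [CommRing A]
    [Algebra k A] [Group Γ] [Finite Γ] [MulSemiringAction Γ A] [SMulCommClass Γ k A]
    (q : Ideal A) [q.IsPrime] :
    ∃ x : A, (∀ τ ∈ q.inertia Γ, τ • x = x) ∧ ∀ σ ∉ q.inertia Γ, σ • x - x ∉ q := by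
  classical
  have := Fintype.ofFinite Γ
  let F : Submodule k A :=
    { carrier := {x | ∀ τ ∈ q.inertia Γ, τ • x = x}
      add_mem' := fun ha hb τ hτ => by rw [smul_add, ha τ hτ, hb τ hτ]
      zero_mem' := fun τ _ => smul_zero τ
      smul_mem' := fun c x hx τ hτ => by rw [smul_comm, hx τ hτ] }
  let W (σ : Γ) : Submodule k A :=
    { carrier := {x | σ • x - x ∈ q}
      add_mem' := fun {a b} ha hb => by
        have : σ • (a + b) - (a + b) = (σ • a - a) + (σ • b - b) := by rw [smul_add]; ring
        change σ • (a + b) - (a + b) ∈ q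
        rw [this]
        exact q.add_mem ha hb
      zero_mem' := by simp
      smul_mem' := fun c x hx => by
        have : σ • c • x - c • x = c • (σ • x - x) := by rw [smul_comm, smul_sub]
        change σ • c • x - c • x ∈ q
        rw [this, Algebra.smul_def]
        exact q.mul_mem_left _ hx }
  have hW : ∀ σ, W σ = ⊤ → σ ∈ q.inertia Γ := fun σ h x =>
    show x ∈ W σ by rw [h]; trivial
  let N := q.inertia Γ
  have key : ∀ σ ∉ N, ∃ x ∈ F, x ∉ W σ := by
    intro σ hσ
    by_contra! hcon
    have hall : ∀ y : A, ∃ τ : N, y ∈ W (σ * τ) := by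
      intro y
      -- The coefficients of this orbit polynomial are N-fixed, hence unchanged by σ modulo q. Its
      -- root y is thus a root modulo q of the σ-translate, so y is congruent to some στy. This
      -- covers A by finitely many subspaces, and over an infinite field one of them is everything.
      let f : A[X] := ∏ τ : N, (X - C (τ • y))
      have hfix (τ : N) : τ • f = f := by
        simp only [f, Finset.smul_prod', smul_sub, smul_X, smul_C, smul_smul]
        exact Fintype.prod_equiv (Equiv.mulLeft τ) _ _ fun _ => rfl
      have hcoeff (n : ℕ) : f.coeff n ∈ F := by
        intro τ hτ
        rw [← coeff_smul]
        exact congrArg (fun g : A[X] => g.coeff n) (hfix ⟨τ, hτ⟩)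
      have hmap : (σ • f).map (Ideal.Quotient.mk q) = f.map (Ideal.Quotient.mk q) := by
        ext n
        rw [coeff_map, coeff_map, coeff_smul]
        exact Ideal.Quotient.eq.2 (hcon _ (hcoeff n))
      have h0 : f.eval y = 0 := by
        simp only [f, eval_prod, eval_sub, eval_X, eval_C]
        exact Finset.prod_eq_zero (Finset.mem_univ 1) (by simp)
      have h1 : (σ • f).eval y ∈ q := by
        rw [← Ideal.Quotient.eq_zero_iff_mem, ← eval₂_at_apply, ← eval_map, hmap, eval_map,
          eval₂_at_apply, h0, map_zero]
      simp only [f, Finset.smul_prod', smul_sub, smul_X, smul_C, eval_prod, eval_sub, eval_X,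
        eval_C] at h1
      obtain ⟨τ, -, h⟩ := (Ideal.IsPrime.prod_mem_iff (hp := ‹q.IsPrime›)).1 h1
      refine ⟨τ, ?_⟩
      have := q.neg_mem h
      rw [neg_sub] at this
      change (σ * (τ : Γ)) • y - y ∈ q
      rw [mul_smul]
      exact this
    obtain ⟨τ, hτ⟩ := Subspace.exists_eq_top_of_iUnion_eq_univ (k := k)
      (p := fun τ : N => W (σ * τ)) (Set.eq_univ_of_forall fun y => Set.mem_iUnion.2 (hall y))
    exact hσ (by simpa using N.mul_mem (hW _ hτ) (N.inv_mem τ.2))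
  -- The same covering argument, now inside the space of N-fixed elements, finds one element that
  -- works for all σ outside N at once.
  by_contra! hcon
  obtain ⟨⟨σ, hσ⟩, h⟩ := Subspace.exists_eq_top_of_iUnion_eq_univ (k := k)
    (p := fun σ : {σ : Γ // σ ∉ N} => (W σ).comap F.subtype)
    (Set.eq_univ_of_forall fun y => by
      obtain ⟨σ, hσ, h⟩ := hcon y.1 y.2
      exact Set.mem_iUnion.2 ⟨⟨σ, hσ⟩, h⟩)
  obtain ⟨x, hx, hxW⟩ := key σ hσ
  have : (⟨x, hx⟩ : F) ∈ (W σ).comap F.subtype := by rw [h]; trivial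
  exact hxW this

section InertiaEtale

open Polynomial

variable {A₀ A₁ A Γ : Type*} [CommRing A₀] [CommRing A₁] [CommRing A]
  [Algebra A₀ A₁] [Algebra A₁ A] [Algebra A₀ A]
  [Group Γ] [Finite Γ] [MulSemiringAction Γ A]

omit [Finite Γ] in
theorem exists_map_eq_of_smul_eq
    (hΓ : ∀ a : A, (∀ σ : Γ, σ • a = a) → a ∈ Set.range (algebraMap A₀ A))
    {f : A[X]} (hf : ∀ σ : Γ, σ • f = f) : ∃ g : A₀[X], g.map (algebraMap A₀ A) = f := by
  have : f ∈ lifts (algebraMap A₀ A) := (lifts_iff_coeff_lifts f).2 fun n =>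
    hΓ _ fun σ => by rw [← coeff_smul, hf]
  simpa [mem_lifts] using this

/-- Let `A₀ ⊆ A₁ ⊆ A` be the fixed rings of a finite group `Γ` and of a subgroup `N`. If `x` is an
element of `A₁` which is moved modulo the prime `q` by every element outside `N`, then `A₁` becomes
étale over `A₀` after inverting a suitable element outside `q`. -/
theorem exists_etale_away [IsScalarTower A₀ A₁ A] [IsDomain A] [FaithfulSMul A₀ A]
    [FaithfulSMul A₁ A]
    (hΓ : ∀ a : A, a ∈ Set.range (algebraMap A₀ A) ↔ ∀ σ : Γ, σ • a = a)
    (N : Subgroup Γ) (hN : ∀ a : A, a ∈ Set.range (algebraMap A₁ A) ↔ ∀ σ ∈ N, σ • a = a)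
    (q : Ideal A) [q.IsPrime] (x : A₁)
    (hx : ∀ σ ∉ N, σ • algebraMap A₁ A x - algebraMap A₁ A x ∉ q) :
    ∃ d : A₁, algebraMap A₁ A d ∉ q ∧ Algebra.Etale A₀ (Localization.Away d) := by
  classical
  have := Fintype.ofFinite (Γ ⧸ N)
  have hinj₀ := FaithfulSMul.algebraMap_injective A₀ A
  have hinj₁ := FaithfulSMul.algebraMap_injective A₁ A
  let φ (y : A₁) (s : Γ ⧸ N) : A := s.out • algebraMap A₁ A y
  have hφmk (y : A₁) (σ : Γ) : φ y (σ : Γ ⧸ N) = σ • algebraMap A₁ A y := by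
    obtain ⟨τ, hτ⟩ := QuotientGroup.mk_out_eq_mul N σ
    simp only [φ]
    rw [hτ, mul_smul, (hN _).1 ⟨y, rfl⟩ τ τ.2]
  have hφ1 (y : A₁) : φ y ((1 : Γ) : Γ ⧸ N) = algebraMap A₁ A y := by rw [hφmk, one_smul]
  have hφ (y : A₁) (σ : Γ) (s : Γ ⧸ N) : σ • φ y s = φ y (σ • s) := by
    induction s using QuotientGroup.induction_on with
    | H τ => rw [MulAction.Quotient.smul_coe, hφmk, hφmk, smul_eq_mul, mul_smul]
  let H (s : Γ ⧸ N) : A[X] := ∏ t, if t = s then 1 else X - C (φ x t)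
  let F : A[X] := ∏ t, (X - C (φ x t))
  have hFH (s : Γ ⧸ N) : F = (X - C (φ x s)) * H s := by
    simp only [F, H]
    rw [← Finset.mul_prod_erase _ _ (Finset.mem_univ s),
      ← Finset.mul_prod_erase Finset.univ (fun t => if t = s then 1 else X - C (φ x t))
        (Finset.mem_univ s), if_pos rfl, one_mul]
    congr 1
    refine Finset.prod_congr rfl fun t ht => ?_
    rw [if_neg (Finset.ne_of_mem_erase ht)]
  have hH0 (s t : Γ ⧸ N) (h : t ≠ s) : (H s).eval (φ x t) = 0 := by
    simp only [H, eval_prod]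
    exact Finset.prod_eq_zero (Finset.mem_univ t) (by simp [h])
  have hHσ (σ : Γ) (s : Γ ⧸ N) : σ • H s = H (σ • s) := by
    simp only [H, Finset.smul_prod']
    refine Fintype.prod_equiv (MulAction.toPerm σ) _ _ fun t => ?_
    simp only [MulAction.toPerm_apply, smul_left_cancel_iff]
    split_ifs
    · simp
    · simp [smul_sub, smul_C, hφ]
  have hFσ (σ : Γ) : σ • F = F := by
    simp only [F, Finset.smul_prod']
    refine Fintype.prod_equiv (MulAction.toPerm σ) _ _ fun t => ?_
    simp [smul_sub, smul_C, hφ]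
  obtain ⟨f, hf⟩ := exists_map_eq_of_smul_eq (A₀ := A₀) (fun a => (hΓ a).2) hFσ
  have hFmonic : F.Monic := monic_prod_of_monic _ _ fun t _ => monic_X_sub_C _
  have hfmonic : f.Monic := monic_of_injective hinj₀ (by rwa [hf])
  have haeval (g : A₀[X]) : algebraMap A₁ A (aeval x g) =
      (g.map (algebraMap A₀ A)).eval (algebraMap A₁ A x) := by
    rw [← aeval_algebraMap_apply, aeval_def, eval_map]
  have hF0 : aeval x f = 0 := by
    apply hinj₁
    rw [haeval, hf, hFH ((1 : Γ) : Γ ⧸ N), hφ1]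
    simp
  let d : A₁ := aeval x (derivative f)
  have hd : algebraMap A₁ A d = (H ((1 : Γ) : Γ ⧸ N)).eval (algebraMap A₁ A x) := by
    rw [haeval, ← derivative_map, hf, hFH ((1 : Γ) : Γ ⧸ N), hφ1]
    simp
  have hdq : algebraMap A₁ A d ∉ q := by
    rw [hd]
    simp only [H, eval_prod]
    rw [Ideal.IsPrime.prod_mem_iff (hp := ‹q.IsPrime›)]
    rintro ⟨t, -, ht⟩
    induction t using QuotientGroup.induction_on with
    | H σ =>
      split_ifs at ht with h
      · exact (Ideal.ne_top_iff_one q).1 ‹q.IsPrime›.ne_top (by simpa using ht)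
      · rw [hφmk] at ht
        refine hx σ (fun hσ => h ?_) (by simpa using q.neg_mem ht)
        exact QuotientGroup.eq.2 (by simpa using N.inv_mem hσ)
  -- Lagrange interpolation: the Γ-invariant polynomial taking the value (sy)f'(sx) at each
  -- conjugate sx. Evaluating it at x gives y·f'(x).
  have hLag (y : A₁) : ∃ g : A₀[X], aeval x g = y * d := by
    obtain ⟨g, hg⟩ := exists_map_eq_of_smul_eq (A₀ := A₀) (fun a => (hΓ a).2)
      (f := ∑ s, C (φ y s) * H s) fun σ => by
        rw [Finset.smul_sum]
        refine Fintype.sum_equiv (MulAction.toPerm σ) _ _ fun s => ?_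
        rw [smul_mul', smul_C, hφ, hHσ, MulAction.toPerm_apply]
    refine ⟨g, hinj₁ ?_⟩
    rw [haeval, hg, map_mul, hd, eval_finsetSum,
      Finset.sum_eq_single_of_mem ((1 : Γ) : Γ ⧸ N) (Finset.mem_univ _), eval_mul, eval_C, hφ1]
    intro s _ hs
    rw [eval_mul, ← hφ1 x, hH0 _ _ hs.symm, mul_zero]
  have hφinj : Function.Injective (φ x) := by
    intro s t hst
    induction s using QuotientGroup.induction_on with
    | H σ =>
      induction t using QuotientGroup.induction_on with
      | H τ =>
        rw [hφmk, hφmk] at hst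
        refine QuotientGroup.eq.2 (by_contra fun h => hx _ h ?_)
        rw [mul_smul, ← hst, inv_smul_smul, sub_self]
        exact q.zero_mem
  -- The conjugates of x are distinct and f has exactly that many roots, so a remainder of smaller
  -- degree vanishing at x, hence at all conjugates, is zero.
  have hdvd (h : A₀[X]) (h0 : aeval x h = 0) : f ∣ h := by
    rw [← modByMonic_eq_zero_iff_dvd hfmonic]
    have hr0 : aeval x (h %ₘ f) = 0 := by
      rw [aeval_modByMonic_eq_self_of_root hF0, h0]
    have hdeg : f.natDegree = Fintype.card (Γ ⧸ N) := by
      rw [← natDegree_map_eq_of_injective hinj₀, hf]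
      simp only [F]
      rw [natDegree_prod_of_monic _ _ fun t _ => monic_X_sub_C _]
      simp
    have hpos : 0 < f.natDegree := by
      rw [hdeg]
      exact Fintype.card_pos_iff.2 ⟨((1 : Γ) : Γ ⧸ N)⟩
    apply map_injective _ hinj₀
    rw [Polynomial.map_zero]
    refine eq_zero_of_natDegree_lt_card_of_eval_eq_zero _ hφinj (fun t => ?_) ?_
    · induction t using QuotientGroup.induction_on with
      | H σ =>
        have hσ : σ • (h %ₘ f).map (algebraMap A₀ A) = (h %ₘ f).map (algebraMap A₀ A) := by
          ext n
          rw [coeff_smul, coeff_map]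
          exact (hΓ _).1 ⟨_, rfl⟩ σ
        rw [hφmk, ← hσ, smul_eval_smul, ← haeval, hr0, map_zero, smul_zero]
    · rw [natDegree_map_eq_of_injective hinj₀, ← hdeg]
      exact natDegree_modByMonic_lt _ hfmonic fun h => by simp [h] at hpos
  have hdom : IsDomain A₁ := hinj₁.isDomain (algebraMap A₁ A)
  have hd0 : d ≠ 0 := fun h => hdq (by rw [h, map_zero]; exact q.zero_mem)
  have hinjL : Function.Injective (algebraMap A₁ (Localization.Away d)) :=
    IsLocalization.injective _ (powers_le_nonZeroDivisors_of_noZeroDivisors hd0)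
  -- Inverting the derivative itself makes the separability condition trivial: f'·1 + f·0 = (f')^1.
  let P : StandardEtalePair A₀ := ⟨f, hfmonic, derivative f, 1, 0, 1, by simp⟩
  have hunit : IsUnit (algebraMap A₁ (Localization.Away d) d) :=
    IsLocalization.Away.algebraMap_isUnit d
  have hP : P.HasMap (algebraMap A₁ (Localization.Away d) x) :=
    ⟨by rw [aeval_algebraMap_apply, hF0, map_zero], by rw [aeval_algebraMap_apply]; exact hunit⟩
  have hlift (g : A₀[X]) : P.lift _ hP (aeval P.X g) = algebraMap A₁ _ (aeval x g) := by
    rw [← aeval_algHom_apply, StandardEtalePair.lift_X, aeval_algebraMap_apply]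
  have hgen (z : P.Ring) : ∃ (n : ℕ) (g : A₀[X]), z * aeval P.X P.g ^ n = aeval P.X g := by
    have he (g : A₀[X]) : P.equivAwayAdjoinRoot (aeval P.X g) =
        algebraMap (AdjoinRoot P.f) _ (AdjoinRoot.mk P.f g) := by
      have : P.equivAwayAdjoinRoot P.X = algebraMap (AdjoinRoot P.f) _ (AdjoinRoot.root P.f) := by
        rw [StandardEtalePair.equivAwayAdjoinRoot]
        exact P.lift_X _ ⟨by rw [aeval_algebraMap_apply, AdjoinRoot.aeval_eq, AdjoinRoot.mk_self,
          map_zero], by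
            rw [aeval_algebraMap_apply, AdjoinRoot.aeval_eq]
            exact IsLocalization.Away.algebraMap_isUnit ..⟩
      rw [← AlgEquiv.coe_toAlgHom, ← aeval_algHom_apply, AlgEquiv.coe_toAlgHom, this,
        aeval_algebraMap_apply, AdjoinRoot.aeval_eq]
    obtain ⟨n, a, h⟩ := IsLocalization.Away.surj (AdjoinRoot.mk P.f P.g) (P.equivAwayAdjoinRoot z)
    obtain ⟨g, rfl⟩ := AdjoinRoot.mk_surjective a
    refine ⟨n, g, P.equivAwayAdjoinRoot.injective ?_⟩
    rw [map_mul, map_pow, he, he, h]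
  have hbij : Function.Bijective (P.lift _ hP) := by
    constructor
    · rw [injective_iff_map_eq_zero]
      intro z hz
      obtain ⟨n, g, hg⟩ := hgen z
      have h0 : aeval x g = 0 := hinjL (by rw [← hlift, ← hg, map_mul, hz, zero_mul, map_zero])
      obtain ⟨c, rfl⟩ := hdvd g h0
      rw [map_mul, P.hasMap_X.1, zero_mul] at hg
      exact (P.hasMap_X.2.pow n).mul_left_eq_zero.1 hg
    · intro w
      obtain ⟨n, y, hy⟩ := IsLocalization.Away.surj d w
      obtain ⟨g, hg⟩ := hLag y
      obtain ⟨u, hu⟩ := P.hasMap_X.2.pow (n + 1)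
      refine ⟨aeval P.X g * (↑u⁻¹ : P.Ring), (hunit.pow (n + 1)).mul_left_injective ?_⟩
      have h1 : P.lift _ hP u = algebraMap A₁ _ d ^ (n + 1) := by
        rw [hu, map_pow, hlift]
      dsimp only
      rw [← h1, ← map_mul, mul_assoc, Units.inv_mul, mul_one, hlift, hg, h1, map_mul, ← hy]
      ring
  exact ⟨d, hdq, Algebra.Etale.of_equiv (AlgEquiv.ofBijective _ hbij)⟩

end InertiaEtale

/-! ### Étale homomorphisms of local rings. -/

open TensorProduct in
/-- If `A → B[1/d]` is étale and `d` is not in the prime `P` of `B`, then the homomorphism of local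
rings at `P` is étale. -/
theorem isEtaleLocalHom_localRingHom_of_etale_away.{u} {A B : Type u} [CommRing A] [CommRing B]
    [Algebra A B] (P : Ideal B) [P.IsPrime] {d : B} (hd : d ∉ P)
    (h : Algebra.Etale A (Localization.Away d)) :
    IsEtaleLocalHom
      (Localization.localRingHom (P.comap (algebraMap A B)) P (algebraMap A B) rfl) := by
  let p := P.comap (algebraMap A B)
  let Aₚ := Localization.AtPrime p
  let BP := Localization.AtPrime P
  let C₁ := Localization.Away d
  let C := Aₚ ⊗[A] C₁
  let f₀ : Aₚ →+* BP := Localization.localRingHom p P (algebraMap A B) rfl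
  have hf₀ (a : A) : f₀ (algebraMap A Aₚ a) = algebraMap B BP (algebraMap A B a) :=
    Localization.localRingHom_to_map ..
  let f₀' : Aₚ →ₐ[A] BP := { f₀ with commutes' := hf₀ }
  have hdu : IsUnit (algebraMap B BP d) := IsLocalization.map_units BP (⟨d, hd⟩ : P.primeCompl)
  let f₁ : C₁ →+* BP := IsLocalization.Away.lift d hdu
  have hf₁ (b : B) : f₁ (algebraMap B C₁ b) = algebraMap B BP b :=
    IsLocalization.Away.lift_eq d hdu b
  let f₁' : C₁ →ₐ[A] BP := { f₁ with commutes' := fun a => hf₁ _ }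
  let φ : C →ₐ[A] BP := Algebra.TensorProduct.productMap f₀' f₁'
  have hφ₀ (a : Aₚ) : φ (algebraMap Aₚ C a) = f₀ a := by
    change φ (a ⊗ₜ 1) = _
    rw [Algebra.TensorProduct.productMap_apply_tmul, map_one, mul_one]
    rfl
  let ι : B →+* C :=
    (Algebra.TensorProduct.includeRight (R := A) (A := Aₚ) (B := C₁)).toRingHom.comp
    (algebraMap B C₁)
  have hφι (b : B) : φ (ι b) = algebraMap B BP b := by
    change φ (1 ⊗ₜ algebraMap B C₁ b) = _
    rw [Algebra.TensorProduct.productMap_apply_tmul, map_one, one_mul]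
    exact hf₁ b
  have hι (a : A) : ι (algebraMap A B a) = algebraMap Aₚ C (algebraMap A Aₚ a) := by
    have h1 : algebraMap B C₁ (algebraMap A B a) = a • 1 := by
      rw [← Algebra.algebraMap_eq_smul_one]
      rfl
    change (1 : Aₚ) ⊗ₜ[A] algebraMap B C₁ (algebraMap A B a) = algebraMap A Aₚ a ⊗ₜ[A] (1 : C₁)
    rw [h1, Algebra.algebraMap_eq_smul_one, TensorProduct.smul_tmul]
  -- Clearing denominators in both tensor factors turns every element of the base change into a
  -- fraction over B with denominator outside P. Localizing the base change therefore gives exactly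
  -- the local ring of B at P.
  have hden (c : C) : ∃ w b : B, w ∉ P ∧ ι w * c = ι b := by
    induction c using TensorProduct.induction_on with
    | zero => exact ⟨1, 0, fun h => ‹P.IsPrime›.ne_top ((Ideal.eq_top_iff_one _).2 h), by simp⟩
    | tmul x y =>
      obtain ⟨⟨a, s⟩, hs⟩ := IsLocalization.surj p.primeCompl x
      obtain ⟨m, b, hb⟩ := IsLocalization.Away.surj d y
      refine ⟨algebraMap A B s * d ^ m, algebraMap A B a * b, ?_, ?_⟩
      · exact P.primeCompl.mul_mem s.2 (P.primeCompl.pow_mem hd m)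
      · have e1 : x ⊗ₜ[A] y = (algebraMap Aₚ C x) * (1 ⊗ₜ[A] y : C) := by
          change _ = (x ⊗ₜ[A] (1 : C₁)) * (1 ⊗ₜ[A] y)
          rw [Algebra.TensorProduct.tmul_mul_tmul, mul_one, one_mul]
        have e2 : (1 ⊗ₜ[A] y : C) * ι d ^ m = ι b := by
          rw [← map_pow]
          change (1 : Aₚ) ⊗ₜ[A] y * ((1 : Aₚ) ⊗ₜ[A] algebraMap B C₁ (d ^ m)) =
            (1 : Aₚ) ⊗ₜ[A] algebraMap B C₁ b
          rw [Algebra.TensorProduct.tmul_mul_tmul, mul_one, map_pow, hb]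
        rw [map_mul, map_mul, map_pow, e1, hι, hι, ← e2, ← hs, map_mul]
        ring
    | add c c' h h' =>
      obtain ⟨w, b, hw, e⟩ := h
      obtain ⟨w', b', hw', e'⟩ := h'
      refine ⟨w * w', w' * b + w * b', P.primeCompl.mul_mem hw hw', ?_⟩
      rw [map_add, map_mul, map_mul, map_mul, ← e, ← e']
      ring
  let n : Ideal C := (IsLocalRing.maximalIdeal BP).comap φ.toRingHom
  have hn (c : C) : c ∉ n ↔ IsUnit (φ c) := by
    change ¬ (φ c ∈ IsLocalRing.maximalIdeal BP) ↔ _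
    rw [IsLocalRing.mem_maximalIdeal, mem_nonunits_iff, not_not]
  have hnι (w : B) (hw : w ∉ P) : ι w ∉ n := by
    rw [hn, hφι]
    exact IsLocalization.map_units BP (⟨w, hw⟩ : P.primeCompl)
  let : Algebra C BP := φ.toRingHom.toAlgebra
  have hloc : IsLocalization.AtPrime BP n :=
    { map_units := fun c => (hn c).1 c.2
      surj := fun z => by
        obtain ⟨⟨b, s⟩, hs⟩ := IsLocalization.surj P.primeCompl z
        refine ⟨⟨ι b, ⟨ι s, hnι _ s.2⟩⟩, ?_⟩
        change z * φ (ι s) = φ (ι b)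
        rw [hφι, hφι, hs]
      exists_of_eq := fun {c c'} hcc => by
        change φ c = φ c' at hcc
        obtain ⟨w, b, hw, e⟩ := hden c
        obtain ⟨w', b', hw', e'⟩ := hden c'
        have h1 : algebraMap B BP (w' * b) = algebraMap B BP (w * b') := by
          rw [← hφι, ← hφι, map_mul ι, map_mul ι, ← e, ← e']
          simp only [map_mul, hcc]
          ring
        obtain ⟨v, hv⟩ := (IsLocalization.eq_iff_exists P.primeCompl BP).1 h1
        refine ⟨⟨ι (v * (w * w')), hnι _
          (P.primeCompl.mul_mem v.2 (P.primeCompl.mul_mem hw hw'))⟩, ?_⟩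
        have h2 := congrArg ι hv
        simp only [map_mul, ← e, ← e'] at h2 ⊢
        linear_combination h2 }
  refine ⟨C, inferInstance, inferInstance, n, inferInstance,
    (IsLocalization.algEquiv n.primeCompl (Localization.AtPrime n) BP).toRingEquiv,
    inferInstance, fun a => ?_⟩
  exact (AlgEquiv.commutes (IsLocalization.algEquiv n.primeCompl (Localization.AtPrime n) BP)
    (algebraMap Aₚ C a)).trans (hφ₀ a)

/-- An étale homomorphism of local rings carries the maximal ideal to the maximal ideal. -/
theorem IsEtaleLocalHom.map_maximalIdeal.{u} {A B : Type u} [CommRing A] [CommRing B]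
    [IsLocalRing A] [IsLocalRing B] (f : A →+* B) [IsLocalHom f] (hf : IsEtaleLocalHom f) :
    (IsLocalRing.maximalIdeal A).map f = IsLocalRing.maximalIdeal B := by
  obtain ⟨C, _, _, n, _, e, hC, he⟩ := hf
  have h : f = e.toRingHom.comp (algebraMap A (Localization.AtPrime n)) := by
    ext a
    rw [← he]
    rfl
  have : IsLocalHom (algebraMap A (Localization.AtPrime n)) := ⟨fun a ha =>
    isUnit_of_map_unit f a (by rw [h]; exact ha.map e.toRingHom)⟩
  have : Algebra.FormallyUnramified C (Localization.AtPrime n) :=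
    .of_isLocalization n.primeCompl
  have : Algebra.FormallyUnramified A (Localization.AtPrime n) := .comp A C _
  have : Algebra.EssFiniteType C (Localization.AtPrime n) := .of_isLocalization _ n.primeCompl
  have : Algebra.EssFiniteType A (Localization.AtPrime n) := .comp A C _
  rw [h, ← Ideal.map_map, Algebra.FormallyUnramified.map_maximalIdeal]
  exact IsLocalRing.map_ringEquiv_maximalIdeal e

/-! ### Order functions and discrete valuation rings. -/

/-- `w` is the normalized order function of a prime `P` whose local ring is a discrete valuation
ring. -/
structure IsOrderAt {A : Type*} [CommRing A] (P : Ideal A) (w : A → ℕ) : Prop where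
  mul : ∀ x y, x ≠ 0 → y ≠ 0 → w (x * y) = w x + w y
  eq_zero_iff : ∀ x, x ≠ 0 → (w x = 0 ↔ x ∉ P)
  le_iff : ∀ x y, x ≠ 0 → y ≠ 0 → (w x ≤ w y ↔ ∃ s ∉ P, ∃ a, s * y = a * x)
  exists_eq_one : ∃ x, x ≠ 0 ∧ w x = 1

namespace IsOrderAt

variable {A : Type*} [CommRing A] [IsDomain A] {P : Ideal A} {w : A → ℕ} (hw : IsOrderAt P w)
include hw

theorem one : w 1 = 0 := by
  have := hw.mul 1 1 one_ne_zero one_ne_zero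
  rw [mul_one] at this
  omega

theorem pow {x : A} (hx : x ≠ 0) (n : ℕ) : w (x ^ n) = n * w x := by
  induction n with
  | zero => rw [pow_zero, hw.one, zero_mul]
  | succ n ih => rw [pow_succ, hw.mul _ _ (pow_ne_zero n hx) hx, ih]; ring

theorem prod {ι : Type*} (s : Finset ι) (f : ι → A) (hf : ∀ i ∈ s, f i ≠ 0) :
    w (∏ i ∈ s, f i) = ∑ i ∈ s, w (f i) := by
  classical
  induction s using Finset.induction_on with
  | empty => simpa using hw.one
  | insert i s his ih =>
    rw [Finset.prod_insert his, Finset.sum_insert his, hw.mul _ _ (hf i (by simp))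
      (Finset.prod_ne_zero_iff.2 fun j hj => hf j (by simp [hj])),
      ih fun j hj => hf j (by simp [hj])]

omit [IsDomain A] in
theorem mono {x y : A} (hy : y ≠ 0) (h : x ∣ y) : w x ≤ w y := by
  obtain ⟨c, rfl⟩ := h
  rw [hw.mul _ _ (left_ne_zero_of_mul hy) (right_ne_zero_of_mul hy)]
  omega

omit [IsDomain A] in
theorem pos_iff {x : A} (hx : x ≠ 0) : 0 < w x ↔ x ∈ P := by
  rw [Nat.pos_iff_ne_zero, Ne, hw.eq_zero_iff x hx, not_not]

end IsOrderAt

theorem algebraMap_dvd_atPrime_iff {A : Type*} [CommRing A] [IsDomain A] (P : Ideal A) [P.IsPrime]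
    (x y : A) : algebraMap A (Localization.AtPrime P) x ∣ algebraMap A _ y ↔
      ∃ s ∉ P, ∃ a, s * y = a * x := by
  constructor
  · rintro ⟨z, hz⟩
    obtain ⟨⟨a, s⟩, hs⟩ := IsLocalization.surj P.primeCompl z
    refine ⟨s, s.2, a, IsLocalization.injective (Localization.AtPrime P)
      P.primeCompl_le_nonZeroDivisors ?_⟩
    rw [map_mul, map_mul, hz, ← hs]
    ring
  · rintro ⟨s, hs, a, h⟩
    have hu : IsUnit (algebraMap A (Localization.AtPrime P) s) :=
      IsLocalization.map_units _ (⟨s, hs⟩ : P.primeCompl)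
    rw [← hu.dvd_mul_left, ← map_mul, h, map_mul]
    exact dvd_mul_left _ _

theorem exists_isOrderAt {A : Type*} [CommRing A] [IsDomain A] (P : Ideal A) [P.IsPrime]
    [IsDiscreteValuationRing (Localization.AtPrime P)] : ∃ w, IsOrderAt P w := by
  have hinj := IsLocalization.injective (Localization.AtPrime P) P.primeCompl_le_nonZeroDivisors
  let v (x : A) := IsDiscreteValuationRing.addVal (Localization.AtPrime P) (algebraMap A _ x)
  have hv (x : A) (hx : x ≠ 0) : ((v x).toNat : ℕ∞) = v x := by
    refine ENat.natCast_toNat fun h => hx (hinj ?_)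
    rw [map_zero]
    exact IsDiscreteValuationRing.addVal_eq_top_iff.1 h
  refine ⟨fun x => (v x).toNat, fun x y hx hy => ?_, fun x hx => ?_, fun x y hx hy => ?_, ?_⟩
  · rw [← Nat.cast_inj (R := ℕ∞), Nat.cast_add, hv _ hx, hv _ hy, hv _ (mul_ne_zero hx hy)]
    simp only [v]
    rw [map_mul, IsDiscreteValuationRing.addVal_mul]
  · rw [← Nat.cast_inj (R := ℕ∞), hv _ hx, Nat.cast_zero,
      IsDiscreteValuationRing.addVal_eq_zero_iff, IsLocalization.AtPrime.isUnit_to_map_iff _ P]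
    rfl
  · rw [← Nat.cast_le (α := ℕ∞), hv _ hx, hv _ hy, IsDiscreteValuationRing.addVal_le_iff_dvd,
      algebraMap_dvd_atPrime_iff]
  · obtain ⟨ϖ, hϖ⟩ := IsDiscreteValuationRing.exists_irreducible (Localization.AtPrime P)
    obtain ⟨⟨a, s⟩, hs⟩ := IsLocalization.surj P.primeCompl ϖ
    have ha : a ≠ 0 := by
      rintro rfl
      simp only [map_zero, mul_eq_zero] at hs
      exact hs.elim hϖ.ne_zero (IsLocalization.map_units (Localization.AtPrime P) s).ne_zero
    refine ⟨a, ha, ?_⟩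
    rw [← Nat.cast_inj (R := ℕ∞), hv _ ha]
    simp only [v]
    rw [← hs, IsDiscreteValuationRing.addVal_mul, IsDiscreteValuationRing.addVal_uniformizer hϖ,
      IsDiscreteValuationRing.addVal_eq_zero_iff.2 (IsLocalization.map_units _ s)]
    rfl

/-- A nonzero ideal of the localization is generated by an element of minimal w in its contraction.
Neither multiplicativity nor normalization of w is needed, so restrictions of valuations to subrings
qualify. -/
theorem isDiscreteValuationRing_atPrime_of_order {A : Type*} [CommRing A] [IsDomain A]
    (P : Ideal A) [P.IsPrime] (hP : P ≠ ⊥) (w : A → ℕ)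
    (hw : ∀ x y, x ≠ 0 → y ≠ 0 → w x ≤ w y → ∃ s ∉ P, ∃ a, s * y = a * x) :
    IsDiscreteValuationRing (Localization.AtPrime P) where
  principal J := by
    by_cases hJ : J.under A = ⊥
    · refine ⟨0, ?_⟩
      rw [← IsLocalization.map_under P.primeCompl _ J, hJ]
      simp
    obtain ⟨x₀, hx₀, hx₀0⟩ := (Submodule.ne_bot_iff _).1 hJ
    obtain ⟨x, ⟨hxJ, hx0⟩, hmin⟩ := exists_minimalFor_of_wellFoundedLT
      (fun x => x ∈ J.under A ∧ x ≠ 0) w ⟨x₀, hx₀, hx₀0⟩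
    refine ⟨algebraMap A _ x, le_antisymm ?_ ?_⟩
    · rw [← IsLocalization.map_under P.primeCompl _ J, Ideal.map_le_iff_le_comap]
      intro y hy
      rw [Ideal.mem_comap]
      by_cases hy0 : y = 0
      · rw [hy0, map_zero]
        exact Submodule.zero_mem _
      have hle : w x ≤ w y := by
        by_contra h
        exact h (hmin ⟨hy, hy0⟩ (by omega))
      exact Ideal.mem_span_singleton.2 ((algebraMap_dvd_atPrime_iff P x y).2 (hw x y hx0 hy0 hle))
    · exact (Ideal.span_singleton_le_iff_mem _).2 hxJ
  not_a_field' := by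
    intro h
    obtain ⟨x, hx, hx0⟩ := (Submodule.ne_bot_iff _).1 hP
    have : algebraMap A (Localization.AtPrime P) x ∈ IsLocalRing.maximalIdeal _ :=
      (IsLocalization.AtPrime.to_map_mem_maximal_iff _ P x).2 hx
    rw [h, Ideal.mem_bot] at this
    exact hx0 (IsLocalization.injective (Localization.AtPrime P) P.primeCompl_le_nonZeroDivisors
      (this.trans (map_zero _).symm))

/-! ### Krull domains and their saturated subrings. -/

theorem Ideal.eq_of_le_of_height_eq_one {A : Type*} [CommRing A] [IsDomain A] {p q : Ideal A}
    [p.IsPrime] [q.IsPrime] (hq : q.height = 1) (hp : p ≠ ⊥) (h : p ≤ q) : p = q := by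
  by_contra hne
  have : q.FiniteHeight := ⟨Or.inr (by simp [hq])⟩
  have := Ideal.height_strict_mono_of_isPrime_of_isPrime (lt_of_le_of_ne h hne)
  rw [hq, Order.lt_one_iff, Ideal.height_eq_zero_iff_eq_bot] at this
  exact hp this

theorem IsKrullDomain.dvd_of_forall {R : Type*} [CommRing R] (hR : IsKrullDomain R) {x y : R}
    (hx : x ≠ 0) (h : ∀ P : Ideal R, P.IsPrime → P.height = 1 → ∃ s ∉ P, ∃ a, s * y = a * x) :
    x ∣ y := by
  have := hR.toIsDomain
  have hx' : algebraMap R (FractionRing R) x ≠ 0 := by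
    rwa [Ne, FaithfulSMul.algebraMap_eq_zero_iff]
  obtain ⟨c, hc⟩ := hR.mem_of_mem_localizations
    (algebraMap R (FractionRing R) y / algebraMap R (FractionRing R) x) fun P hP hP1 => by
      obtain ⟨s, hs, a, e⟩ := h P hP hP1
      refine ⟨a, s, hs, ?_⟩
      rw [div_mul_eq_mul_div, div_eq_iff hx', ← map_mul, ← map_mul, ← e, mul_comm]
  refine ⟨c, FaithfulSMul.algebraMap_injective R (FractionRing R) ?_⟩
  rw [map_mul, hc, mul_div_cancel₀ _ hx']

/-- A subring `A` of a Krull domain `R` such that `A = R ∩ Frac A` has discrete valuation rings as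
local rings at the primes of height one. -/
theorem IsKrullDomain.isDiscreteValuationRing_of_saturated {A R : Type*} [CommRing A] [IsDomain A]
    [CommRing R] [Algebra A R] [FaithfulSMul A R] (hR : IsKrullDomain R)
    (hsat : ∀ x y : A, x ≠ 0 → algebraMap A R x ∣ algebraMap A R y → x ∣ y)
    (q : Ideal A) [q.IsPrime] (hq : q.height = 1) :
    IsDiscreteValuationRing (Localization.AtPrime q) := by
  classical
  have := hR.toIsDomain
  let i := algebraMap A R
  have hi0 {x : A} (hx : x ≠ 0) : i x ≠ 0 := by
    rwa [Ne, FaithfulSMul.algebraMap_eq_zero_iff]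
  let S := {P : Ideal R // P.IsPrime ∧ P.height = 1}
  have (P : S) : ∃ w, IsOrderAt P.1 w := by
    have := P.2.1
    obtain ⟨_, _⟩ := hR.localization_isDVR P.1 P.2.2
    exact exists_isOrderAt P.1
  choose w hw using this
  have hdvd (x y : A) (hx : x ≠ 0) (hy : y ≠ 0) (h : ∀ P, w P (i x) ≤ w P (i y)) : x ∣ y :=
    hsat x y hx (hR.dvd_of_forall (hi0 hx) fun P hP hP1 =>
      ((hw ⟨P, hP, hP1⟩).le_iff _ _ (hi0 hx) (hi0 hy)).1 (h _))
  have hfin (x : A) (hx : x ≠ 0) : {P : S | i x ∈ P.1}.Finite :=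
    Set.Finite.of_finite_image ((hR.finite_height_one (i x) (hi0 hx)).subset (by
      rintro _ ⟨P, hP, rfl⟩
      exact ⟨P.2.1, P.2.2, hP⟩)) Subtype.val_injective.injOn
  -- A prime P that meets A nontrivially but not in q cannot meet it inside q, since q has height
  -- one. This supplies an element of P ∩ A outside q.
  have h_common (P : S) : ∃ b : A, ∀ x : A, x ≠ 0 → i x ∈ P.1 → P.1.comap i ≠ q →
      i b ∈ P.1 ∧ b ∉ q := by
    by_cases h : P.1.comap i ≤ q
    · refine ⟨0, fun x hx hxP hne => (hne ?_).elim⟩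
      have := P.2.1
      exact Ideal.eq_of_le_of_height_eq_one hq
        ((Submodule.ne_bot_iff _).2 ⟨x, hxP, hx⟩) h
    · obtain ⟨b, hb, hbq⟩ := SetLike.not_le_iff_exists.1 h
      exact ⟨b, fun _ _ _ _ => ⟨hb, hbq⟩⟩
  choose b hb using h_common
  -- Only primes over q matter for divisibility in the local ring at q. The finitely many other
  -- primes containing x are compensated by a product of powers of the elements b, which is a unit
  -- there.
  have h_dvd (x y : A) (hx : x ≠ 0) (hy : y ≠ 0)
      (h : ∀ P : S, P.1.comap i = q → w P (i x) ≤ w P (i y)) : ∃ s ∉ q, ∃ a, s * y = a * x := by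
    let F := (hfin x hx).toFinset.filter fun P => P.1.comap i ≠ q
    have hF (P : S) (hP : P ∈ F) : i (b P) ∈ P.1 ∧ b P ∉ q := by
      simp only [F, Finset.mem_filter, Set.Finite.mem_toFinset] at hP
      exact hb P x hx hP.1 hP.2
    let s := ∏ P ∈ F, b P ^ w P (i x)
    have hs : s ∉ q := by
      simp only [s]
      rw [Ideal.IsPrime.prod_mem_iff (hp := ‹q.IsPrime›)]
      rintro ⟨P, hP, h⟩
      exact (hF P hP).2 (Ideal.IsPrime.mem_of_pow_mem ‹_› _ h)
    have hs0 : s ≠ 0 := fun h => hs (h ▸ q.zero_mem)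
    obtain ⟨a, ha⟩ := hdvd x (s * y) hx (mul_ne_zero hs0 hy) fun P => by
      rw [map_mul, (hw P).mul _ _ (hi0 hs0) (hi0 hy)]
      by_cases hPq : P.1.comap i = q
      · exact (h P hPq).trans (Nat.le_add_left _ _)
      by_cases hxP : i x ∈ P.1
      · have hPF : P ∈ F := by simpa [F] using ⟨hxP, hPq⟩
        have hb0 : i (b P) ≠ 0 := hi0 fun h => (hF P hPF).2 (h ▸ q.zero_mem)
        have h1 : w P (i (b P ^ w P (i x))) ≤ w P (i s) :=
          (hw P).mono (hi0 hs0) (map_dvd i (Finset.dvd_prod_of_mem _ hPF))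
        rw [map_pow, (hw P).pow hb0] at h1
        have h2 := ((hw P).pos_iff hb0).2 (hF P hPF).1
        have h3 := Nat.le_mul_of_pos_right (w P (i x)) h2
        omega
      · rw [((hw P).eq_zero_iff _ (hi0 hx)).2 hxP]
        exact Nat.zero_le _
    exact ⟨s, hs, a, by rw [ha, mul_comm]⟩
  have hqbot : q ≠ ⊥ := by
    rintro rfl
    simp [Ideal.height_bot] at hq
  obtain ⟨t, htq, ht0⟩ := (Submodule.ne_bot_iff _).1 hqbot
  let Sq : Set S := {P | P.1.comap i = q}
  have hSq (P : S) (hP : P ∈ Sq) (x : A) (hx : x ≠ 0) : w P (i x) = 0 ↔ x ∉ q := by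
    rw [(hw P).eq_zero_iff _ (hi0 hx), ← show P.1.comap i = q from hP]
    rfl
  have hSqfin : Sq.Finite := (hfin t ht0).subset fun P hP => by
    have : t ∈ P.1.comap i := by rwa [show P.1.comap i = q from hP]
    exact this
  obtain ⟨P₁, hP₁⟩ : Sq.Nonempty := by
    by_contra hne
    rw [Set.not_nonempty_iff_eq_empty] at hne
    obtain ⟨s, hs, a, h⟩ := h_dvd t 1 ht0 one_ne_zero fun P hP => by
      have : P ∈ Sq := hP
      simp [hne] at this
    rw [mul_one] at h
    exact hs (h ▸ q.mul_mem_left a htq)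
  have htpos (P : S) (hP : P ∈ Sq) : 0 < w P (i t) :=
    Nat.pos_of_ne_zero fun h => (hSq P hP t ht0).1 h htq
  -- Any single prime over q already decides divisibility. If P₁ and P₂ disagreed on y/x, take P₀
  -- minimizing the slope of y/x relative to t. Then y^α t^k / x^α has nonnegative order over q and
  -- order zero at P₀, so it is a unit at q; yet its order at P₁ is positive.
  refine isDiscreteValuationRing_atPrime_of_order q hqbot (fun x => w P₁ (i x))
    fun x y hx hy hxy => h_dvd x y hx hy ?_
  by_contra! hcon
  obtain ⟨P₂, hP₂, hlt₂⟩ := hcon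
  obtain ⟨P₀, hP₀, hmin⟩ := Set.exists_min_image Sq
    (fun P => ((w P (i y) : ℚ) - w P (i x)) / w P (i t)) hSqfin ⟨P₁, hP₁⟩
  have hmin' (P : S) (hP : P ∈ Sq) :
      ((w P₀ (i y) : ℤ) - w P₀ (i x)) * w P (i t) ≤ (w P (i y) - w P (i x)) * w P₀ (i t) := by
    have h1 : (0 : ℚ) < w P (i t) := by exact_mod_cast htpos P hP
    have h2 : (0 : ℚ) < w P₀ (i t) := by exact_mod_cast htpos P₀ hP₀
    have := hmin P hP
    rw [div_le_div_iff₀ h2 h1] at this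
    exact_mod_cast this
  have hlt₀ : w P₀ (i y) < w P₀ (i x) := by
    by_contra! h
    have h1 := hmin' P₂ hP₂
    have h2 : (0 : ℤ) < w P₀ (i t) := by exact_mod_cast htpos P₀ hP₀
    have h3 : (0 : ℤ) ≤ (w P₀ (i y) - w P₀ (i x)) * w P₂ (i t) :=
      mul_nonneg (by omega) (by omega)
    have h4 : ((w P₂ (i y) : ℤ) - w P₂ (i x)) * w P₀ (i t) < 0 :=
      mul_neg_of_neg_of_pos (by omega) h2
    omega
  obtain ⟨m, hm⟩ := Nat.exists_eq_add_of_lt hlt₀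
  let k := m + 1
  let α := w P₀ (i t)
  have hX0 : x ^ α ≠ 0 := pow_ne_zero _ hx
  have hY0 : y ^ α * t ^ k ≠ 0 := mul_ne_zero (pow_ne_zero _ hy) (pow_ne_zero _ ht0)
  have hwX (P : S) : w P (i (x ^ α)) = α * w P (i x) := by
    rw [map_pow, (hw P).pow (hi0 hx)]
  have hwY (P : S) : w P (i (y ^ α * t ^ k)) = α * w P (i y) + k * w P (i t) := by
    rw [map_mul, map_pow, map_pow, (hw P).mul _ _ (pow_ne_zero _ (hi0 hy))
      (pow_ne_zero _ (hi0 ht0)), (hw P).pow (hi0 hy), (hw P).pow (hi0 ht0)]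
  obtain ⟨s, hs, c, hc⟩ := h_dvd (x ^ α) (y ^ α * t ^ k) hX0 hY0 fun P hP => by
    have h1 := hmin' P hP
    rw [hwX, hwY]
    have h2 : ((w P₀ (i y) : ℤ) - w P₀ (i x)) = -k := by
      simp only [k]
      push_cast
      omega
    rw [h2] at h1
    zify
    linarith
  have hs0 : s ≠ 0 := fun h => hs (h ▸ q.zero_mem)
  have hc0 : c ≠ 0 := fun h => mul_ne_zero hs0 hY0 (by rw [hc, h, zero_mul])
  have hwc (P : S) (hP : P ∈ Sq) : α * w P (i y) + k * w P (i t) = w P (i c) + α * w P (i x) := by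
    have := congrArg (fun z => w P (i z)) hc
    simp only [map_mul i s, map_mul i c] at this
    rw [(hw P).mul _ _ (hi0 hs0) (hi0 hY0), (hw P).mul _ _ (hi0 hc0) (hi0 hX0), hwX, hwY,
      (hSq P hP s hs0).2 hs, zero_add] at this
    exact this
  have hcq : c ∉ q := by
    rw [← hSq P₀ hP₀ c hc0]
    have h1 := hwc P₀ hP₀
    rw [hm] at h1
    simp only [k, α] at h1
    have : w P₀ (i c) + w P₀ (i t) * (w P₀ (i y) + m + 1) =
      w P₀ (i t) * (w P₀ (i y) + m + 1) := by rw [← h1]; ring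
    omega
  have h1 := hwc P₁ hP₁
  rw [(hSq P₁ hP₁ c hc0).2 hcq, zero_add] at h1
  have h2 : 0 < k * w P₁ (i t) := Nat.mul_pos (Nat.succ_pos m) (htpos P₁ hP₁)
  have h3 : α * w P₁ (i x) ≤ α * w P₁ (i y) := Nat.mul_le_mul_left _ hxy
  omega

/-! ### Height-one primes and valuations in fixed rings. -/

section FixedRing

variable {B A N : Type*} [CommRing B] [CommRing A] [Algebra B A] [Group N] [Finite N]
  [MulSemiringAction N A]

/-- The norm of a, split off at the factor of the identity. It is used to replace denominators by
invariant ones. -/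
theorem exists_norm_eq_mul
    (hN : ∀ a : A, a ∈ Set.range (algebraMap B A) ↔ ∀ σ : N, σ • a = a) (a : A) :
    ∃ (b : B) (t : A), algebraMap B A b = t * a ∧
      ∀ q : Ideal A, q.IsPrime → (∀ σ : N, σ • a ∉ q) → algebraMap B A b ∉ q := by
  classical
  have := Fintype.ofFinite N
  obtain ⟨b, hb⟩ := (hN (∏ σ : N, σ • a)).2 fun τ => by
    rw [Finset.smul_prod']
    exact Fintype.prod_equiv (Equiv.mulLeft τ) _ _ fun σ => by simp [mul_smul]
  refine ⟨b, ∏ σ ∈ Finset.univ.erase (1 : N), σ • a, ?_, fun q hq h => ?_⟩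
  · rw [hb, ← Finset.prod_erase_mul _ _ (Finset.mem_univ (1 : N)), one_smul]
  · rw [hb, Ideal.IsPrime.prod_mem_iff]
    rintro ⟨σ, -, hσ⟩
    exact h σ hσ

variable [IsDomain A]

theorem comap_ne_bot_of_fixed
    (hN : ∀ a : A, a ∈ Set.range (algebraMap B A) ↔ ∀ σ : N, σ • a = a)
    {q : Ideal A} (hq : q ≠ ⊥) : q.comap (algebraMap B A) ≠ ⊥ := by
  obtain ⟨a, haq, ha⟩ := (Submodule.ne_bot_iff _).1 hq
  obtain ⟨b, t, hb, hb'⟩ := exists_norm_eq_mul hN a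
  refine (Submodule.ne_bot_iff _).2 ⟨b, ?_, ?_⟩
  · rw [Ideal.mem_comap, hb]
    exact q.mul_mem_left t haq
  · rintro rfl
    refine hb' ⊥ Ideal.isPrime_bot (fun σ h => ha ?_) (by simp)
    rwa [Ideal.mem_bot, smul_eq_zero_iff_eq] at h

variable [FaithfulSMul B A]

-- Integrality gives lying over and going up, and the group is transitive on the primes over a given
-- one. A chain below the contraction thus lifts and can be moved to a chain below q. Norms show
-- that the contraction is nonzero.
open Pointwise in
theorem height_comap_eq_one_of_fixed
    (hN : ∀ a : A, a ∈ Set.range (algebraMap B A) ↔ ∀ σ : N, σ • a = a)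
    (q : Ideal A) [q.IsPrime] (hq : q.height = 1) : (q.comap (algebraMap B A)).height = 1 := by
  have hinj := FaithfulSMul.algebraMap_injective B A
  have hdom : IsDomain B := hinj.isDomain (algebraMap B A)
  have hcomm : SMulCommClass N B A := ⟨fun σ b a => by
    rw [Algebra.smul_def, Algebra.smul_def, smul_mul', (hN _).1 ⟨b, rfl⟩]⟩
  have hinv : Algebra.IsInvariant B A N := ⟨fun a ha => (hN a).2 ha⟩
  have hint : Algebra.IsIntegral B A := Algebra.IsInvariant.isIntegral B A N
  have hqbot : q ≠ ⊥ := by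
    rintro rfl
    simp [Ideal.height_bot] at hq
  refine le_antisymm (Ideal.height_le_iff.2 fun p₁ hp₁ hlt => ?_) ?_
  · rw [Nat.cast_one, Order.lt_one_iff, Ideal.height_eq_zero_iff_eq_bot]
    obtain ⟨q₁, -, hq₁, hq₁p⟩ := Ideal.exists_ideal_over_prime_of_isIntegral (S := A) p₁ ⊥ (by
      rw [Ideal.comap_bot_of_injective _ hinj]
      exact bot_le)
    obtain ⟨q₂, hle, hq₂, hq₂p⟩ := Ideal.exists_ideal_over_prime_of_isIntegral (S := A)
      (q.comap (algebraMap B A)) q₁ (hq₁p.trans_le hlt.le)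
    obtain ⟨σ, hσ⟩ := Algebra.IsInvariant.exists_smul_of_under_eq B A N q q₂ hq₂p.symm
    by_contra hp₁bot
    have hq₁bot : σ⁻¹ • q₁ ≠ ⊥ := by
      intro h
      rw [inv_smul_eq_iff, Ideal.smul_bot] at h
      rw [h, Ideal.comap_bot_of_injective _ hinj] at hq₁p
      exact hp₁bot hq₁p.symm
    have hle' : σ⁻¹ • q₁ ≤ q := by
      rw [Ideal.pointwise_smul_subset_iff, inv_inv, ← hσ]
      exact hle
    have heq := Ideal.eq_of_le_of_height_eq_one hq hq₁bot hle'
    rw [inv_smul_eq_iff, ← hσ] at heq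
    rw [← heq, hq₁p] at hq₂p
    exact hlt.ne hq₂p
  · rw [Order.one_le_iff_pos, pos_iff_ne_zero, Ne, Ideal.height_eq_zero_iff_eq_bot]
    exact comap_ne_bot_of_fixed hN hqbot

/-- Replace the denominator s by its norm, which avoids q because N preserves the complement of q.
The new numerator is then fixed by cancellation in the domain. -/
theorem exists_mul_eq_of_fixed
    (hN : ∀ a : A, a ∈ Set.range (algebraMap B A) ↔ ∀ σ : N, σ • a = a)
    (q : Ideal A) [q.IsPrime] (hq : ∀ (σ : N) (a : A), σ • a ∈ q → a ∈ q) {x y : B} (hx : x ≠ 0)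
    (h : ∃ s ∉ q, ∃ a, s * algebraMap B A y = a * algebraMap B A x) :
    ∃ s ∉ q.comap (algebraMap B A), ∃ a, s * y = a * x := by
  have hinj := FaithfulSMul.algebraMap_injective B A
  obtain ⟨s, hs, a, e⟩ := h
  obtain ⟨b, t, hb, hb'⟩ := exists_norm_eq_mul hN s
  have hx0 : algebraMap B A x ≠ 0 := by rwa [Ne, FaithfulSMul.algebraMap_eq_zero_iff]
  have e' : algebraMap B A (b * y) = (t * a) * algebraMap B A x := by
    rw [map_mul, hb, mul_assoc, e, mul_assoc]
  obtain ⟨a', ha'⟩ := (hN (t * a)).2 fun σ => by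
    have h1 := congrArg (σ • ·) e'
    simp only [smul_mul', (hN _).1 ⟨_, rfl⟩ σ] at h1
    rw [e', ← smul_mul'] at h1
    exact (mul_right_cancel₀ hx0 h1).symm
  refine ⟨b, fun h => hb' q ‹_› (fun σ h => hs (hq σ s h)) h, a', hinj ?_⟩
  rw [e', map_mul, ha']

theorem isDiscreteValuationRing_atPrime_of_fixed [IsDomain B]
    (hN : ∀ a : A, a ∈ Set.range (algebraMap B A) ↔ ∀ σ : N, σ • a = a)
    (q : Ideal A) [q.IsPrime] (hqbot : q ≠ ⊥) (hq : ∀ (σ : N) (a : A), σ • a ∈ q → a ∈ q)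
    [IsDiscreteValuationRing (Localization.AtPrime q)] :
    IsDiscreteValuationRing (Localization.AtPrime (q.comap (algebraMap B A))) := by
  obtain ⟨w, hw⟩ := exists_isOrderAt q
  refine isDiscreteValuationRing_atPrime_of_order _ (comap_ne_bot_of_fixed hN hqbot)
    (fun b => w (algebraMap B A b)) fun x y hx hy hxy => ?_
  have hx0 : algebraMap B A x ≠ 0 := by rwa [Ne, FaithfulSMul.algebraMap_eq_zero_iff]
  have hy0 : algebraMap B A y ≠ 0 := by rwa [Ne, FaithfulSMul.algebraMap_eq_zero_iff]
  exact exists_mul_eq_of_fixed hN q hq hx ((hw.le_iff _ _ hx0 hy0).1 hxy)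

end FixedRing

namespace IsOrderAt

variable {A : Type*} [CommRing A] [IsDomain A] {q : Ideal A} [q.IsPrime] {w : A → ℕ}
  (hw : IsOrderAt q w)
include hw

/-- The symbolic powers of `q`. -/
theorem exists_ideal (n : ℕ) : ∃ J : Ideal A, ∀ x, x ≠ 0 → (x ∈ J ↔ n ≤ w x) := by
  obtain ⟨π, hπ, hπ1⟩ := hw.exists_eq_one
  have hn : w (π ^ n) = n := by rw [hw.pow hπ, hπ1, mul_one]
  refine ⟨
    { carrier := {x | ∃ s ∉ q, ∃ a, s * x = a * π ^ n}
      zero_mem' := ⟨1, q.primeCompl.one_mem, 0, by simp⟩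
      add_mem' := ?_
      smul_mem' := ?_ }, fun x hx => ?_⟩
  · rintro x y ⟨s, hs, a, h⟩ ⟨t, ht, b, h'⟩
    exact ⟨s * t, q.primeCompl.mul_mem hs ht, t * a + s * b, by linear_combination t * h + s * h'⟩
  · rintro c x ⟨s, hs, a, h⟩
    exact ⟨s, hs, c * a, by rw [smul_eq_mul]; linear_combination c * h⟩
  · have := hw.le_iff (π ^ n) x (pow_ne_zero _ hπ) hx
    rw [hn] at this
    exact this.symm

omit [q.IsPrime] in
theorem exists_pow_associated {π x : A} (hπ : π ≠ 0) (hπ1 : w π = 1) (hx : x ≠ 0) :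
    ∃ s ∉ q, ∃ c ∉ q, s * x = c * π ^ w x := by
  have hn : w (π ^ w x) = w x := by rw [hw.pow hπ, hπ1, mul_one]
  obtain ⟨s, hs, c, h⟩ := (hw.le_iff (π ^ w x) x (pow_ne_zero _ hπ) hx).1 hn.le
  have hs0 : s ≠ 0 := fun h => hs (h ▸ q.zero_mem)
  have hc0 : c ≠ 0 := by
    rintro rfl
    exact mul_ne_zero hs0 hx (by rw [h, zero_mul])
  refine ⟨s, hs, c, ?_, h⟩
  rw [← hw.eq_zero_iff c hc0]
  have := congrArg w h
  rw [hw.mul _ _ hs0 hx, hw.mul _ _ hc0 (pow_ne_zero _ hπ), hn, (hw.eq_zero_iff s hs0).2 hs] at this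
  omega

-- An automorphism preserving q preserves the divisibility preorder at q. It therefore multiplies
-- orders by the order of σπ, and applying this to σ⁻¹π shows that the factor is 1.
omit [q.IsPrime] in
theorem smul {Γ : Type*} [Group Γ] [MulSemiringAction Γ A] {σ : Γ} (hσ : ∀ a, σ • a ∈ q ↔ a ∈ q)
    {x : A} (hx : x ≠ 0) : w (σ • x) = w x := by
  have hne {x : A} (hx : x ≠ 0) : σ • x ≠ 0 := (smul_ne_zero_iff_ne σ).2 hx
  have key {x y : A} (hx : x ≠ 0) (hy : y ≠ 0) : w (σ • x) ≤ w (σ • y) ↔ w x ≤ w y := by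
    rw [hw.le_iff _ _ hx hy, hw.le_iff _ _ (hne hx) (hne hy)]
    constructor
    · rintro ⟨s, hs, a, h⟩
      refine ⟨σ⁻¹ • s, by rwa [← hσ, smul_inv_smul], σ⁻¹ • a, smul_left_cancel σ ?_⟩
      rw [smul_mul', smul_mul', smul_inv_smul, smul_inv_smul, h]
    · rintro ⟨s, hs, a, h⟩
      exact ⟨σ • s, by rwa [hσ], σ • a, by rw [← smul_mul', h, smul_mul']⟩
  obtain ⟨π, hπ, hπ1⟩ := hw.exists_eq_one
  have hn (x : A) : w (π ^ w x) = w x := by rw [hw.pow hπ, hπ1, mul_one]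
  have hval {x : A} (hx : x ≠ 0) : w (σ • x) = w x * w (σ • π) := by
    rw [← hw.pow (hne hπ), ← smul_pow']
    exact le_antisymm ((key hx (pow_ne_zero _ hπ)).2 (hn x).ge)
      ((key (pow_ne_zero _ hπ) hx).2 (hn x).le)
  have h1 := hval (x := σ⁻¹ • π) ((smul_ne_zero_iff_ne σ⁻¹).2 hπ)
  rw [smul_inv_smul, hπ1] at h1
  rw [hval hx, Nat.eq_one_of_mul_eq_one_left h1.symm, mul_one]

end IsOrderAt

/-! ### The tame character and wild inertia. -/

section Tame

variable {A Γ : Type*} [CommRing A] [IsDomain A] [Group Γ] [MulSemiringAction Γ A]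
  {q : Ideal A} [q.IsPrime] {w : A → ℕ}

omit [IsDomain A] [q.IsPrime] in
theorem smul_mem_iff_of_mem_inertia {σ : Γ} (hσ : σ ∈ q.inertia Γ) (a : A) : σ • a ∈ q ↔ a ∈ q :=
  ⟨fun h => by simpa using q.sub_mem h (hσ a), fun h => by simpa using q.add_mem (hσ a) h⟩

/-- The tame character of the inertia group. -/
theorem exists_tame_character (hw : IsOrderAt q w) {κ : Type*} [Field κ] (r : A →+* κ)
    (hr : ∀ a, r a = 0 ↔ a ∈ q) {π : A} (hπ : π ≠ 0) (hπ1 : w π = 1) :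
    ∃ χ : q.inertia Γ →* κˣ, ∀ (σ : q.inertia Γ) (s c : A), s * σ • π = c * π →
      r s * χ σ = r c := by
  have hne (σ : q.inertia Γ) : σ • π ≠ 0 := (smul_ne_zero_iff_ne (σ : Γ)).2 hπ
  have hex (σ : q.inertia Γ) : ∃ s ∉ q, ∃ c ∉ q, s * σ • π = c * π := by
    have h := hw.exists_pow_associated hπ hπ1 (hne σ)
    rwa [show w (σ • π) = 1 from (hw.smul (smul_mem_iff_of_mem_inertia σ.2) hπ).trans hπ1,
      pow_one] at h
  -- Inertia acts trivially on residues; this turns the cocycle σπ/π into a homomorphism after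
  -- reduction.
  have hrσ (σ : q.inertia Γ) (a : A) : r (σ • a) = r a := by
    rw [← sub_eq_zero, ← map_sub, hr]
    exact σ.2 a
  have hu (σ : q.inertia Γ) : ∃ u : κˣ, ∀ s c : A, s * σ • π = c * π → r s * u = r c := by
    obtain ⟨s, hs, c, hc, h⟩ := hex σ
    have hs' : r s ≠ 0 := fun h => hs ((hr s).1 h)
    have hc' : r c ≠ 0 := fun h => hc ((hr c).1 h)
    refine ⟨Units.mk0 (r c / r s) (div_ne_zero hc' hs'), fun s' c' h' => ?_⟩
    have : s' * c = s * c' := mul_right_cancel₀ hπ (by linear_combination s * h' - s' * h)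
    rw [Units.val_mk0, mul_div_assoc', div_eq_iff hs', ← map_mul, this, map_mul, mul_comm]
  choose u hu using hu
  have huniq (σ : q.inertia Γ) (v : κ) (s c : A) (hs : s ∉ q) (h : s * σ • π = c * π)
      (hv : r s * v = r c) : (u σ : κ) = v :=
    mul_left_cancel₀ (fun h => hs ((hr s).1 h)) ((hu σ s c h).trans hv.symm)
  refine ⟨MonoidHom.mk' u fun σ τ => Units.ext ?_, hu⟩
  obtain ⟨s, hs, c, -, h⟩ := hex σ
  obtain ⟨t, ht, d, -, h'⟩ := hex τ
  have h'' := congrArg (σ • ·) h'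
  simp only [smul_mul'] at h''
  refine huniq (σ * τ) _ (s * σ • t) (c * σ • d) (q.primeCompl.mul_mem hs fun h =>
    ht ((smul_mem_iff_of_mem_inertia σ.2 t).1 h)) ?_ ?_
  · rw [mul_smul]
    linear_combination s * h'' + σ • d * h
  · rw [map_mul, map_mul, Units.val_mul, hrσ, hrσ, ← hu σ s c h, ← hu τ t d h']
    ring

/-- Up to units at q, d is uπ^k with k its order. Both u and σπ/π change only modulo q under the
hypotheses, so σd and d have the same leading term. -/
theorem lt_order_smul_sub (hw : IsOrderAt q w) {κ : Type*} [Field κ] (r : A →+* κ)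
    (hr : ∀ a, r a = 0 ↔ a ∈ q) {π : A} (hπ : π ≠ 0) (hπ1 : w π = 1) {σ : Γ}
    (hσ : σ ∈ q.inertia Γ) (hχ : ∀ s c : A, s * σ • π = c * π → r s = r c) {d : A} (hd : d ≠ 0)
    (hσd : σ • d ≠ d) : w d < w (σ • d - d) := by
  have hrσ (a : A) : r (σ • a) = r a := by
    rw [← sub_eq_zero, ← map_sub, hr]
    exact hσ a
  have hne : σ • π ≠ 0 := (smul_ne_zero_iff_ne σ).2 hπ
  obtain ⟨s, hs, c, -, h⟩ := hw.exists_pow_associated hπ hπ1 hne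
  rw [show w (σ • π) = 1 from (hw.smul (smul_mem_iff_of_mem_inertia hσ) hπ).trans hπ1,
    pow_one] at h
  obtain ⟨t, ht, e, -, h'⟩ := hw.exists_pow_associated hπ hπ1 hd
  have hsc := hχ s c h
  generalize w d = k at *
  have h1 : s ^ k * σ • t * σ • d = σ • e * c ^ k * π ^ k := by
    have h2 := congrArg (σ • ·) h'
    simp only [smul_mul', smul_pow'] at h2
    have h3 : s ^ k * (σ • π) ^ k = c ^ k * π ^ k := by rw [← mul_pow, h, mul_pow]
    linear_combination s ^ k * h2 + σ • e * h3
  let b := t * σ • e * c ^ k - s ^ k * σ • t * e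
  have hb : s ^ k * σ • t * t * (σ • d - d) = b * π ^ k := by
    simp only [b]
    linear_combination t * h1 - s ^ k * σ • t * h'
  have hbq : b ∈ q := by
    rw [← hr]
    simp only [b, map_sub, map_mul, map_pow, hrσ, hsc]
    ring
  have hu : s ^ k * σ • t * t ∉ q := q.primeCompl.mul_mem (q.primeCompl.mul_mem
    (q.primeCompl.pow_mem hs k) fun h => ht ((smul_mem_iff_of_mem_inertia hσ t).1 h)) ht
  have hu0 : s ^ k * σ • t * t ≠ 0 := fun h => hu (h ▸ q.zero_mem)
  have hd0 : σ • d - d ≠ 0 := sub_ne_zero.2 hσd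
  have hb0 : b ≠ 0 := by
    intro h
    exact mul_ne_zero hu0 hd0 (by rw [hb, h, zero_mul])
  have h2 := congrArg w hb
  rw [hw.mul _ _ hu0 hd0, (hw.eq_zero_iff _ hu0).2 hu, hw.mul _ _ hb0 (pow_ne_zero _ hπ),
    hw.pow hπ, hπ1] at h2
  have := (hw.pos_iff hb0).2 hbq
  omega

/-- An element of the wild inertia group which acts with finite order prime to the residue
characteristic acts trivially. -/
theorem smul_eq_of_pow_smul_eq (hw : IsOrderAt q w) {κ : Type*} [Field κ] (r : A →+* κ)
    (hr : ∀ a, r a = 0 ↔ a ∈ q) {π : A} (hπ : π ≠ 0) (hπ1 : w π = 1) {σ : Γ}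
    (hσ : σ ∈ q.inertia Γ) (hχ : ∀ s c : A, s * σ • π = c * π → r s = r c) {n : ℕ}
    (hn : (n : A) ∉ q) (hσn : ∀ a : A, σ ^ n • a = a) (y : A) : σ • y = y := by
  by_contra hne
  let d := σ • y - y
  have hd : d ≠ 0 := sub_ne_zero.2 hne
  obtain ⟨J, hJ⟩ := hw.exists_ideal (w d + 1)
  have hJσ {x : A} (hx : x ∈ J) : σ • x ∈ J := by
    by_cases h0 : x = 0
    · rw [h0, smul_zero]
      exact J.zero_mem
    · rwa [hJ _ ((smul_ne_zero_iff_ne σ).2 h0), hw.smul (smul_mem_iff_of_mem_inertia hσ) h0,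
        ← hJ x h0]
  have hdJ : σ • d - d ∈ J := by
    by_cases h : σ • d = d
    · rw [h, sub_self]
      exact J.zero_mem
    · exact (hJ _ (sub_ne_zero.2 h)).2 (lt_order_smul_sub hw r hr hπ hπ1 hσ hχ hd h)
  have hi (i : ℕ) : σ ^ i • d - d ∈ J := by
    induction i with
    | zero => simp
    | succ i ih =>
      have : σ ^ (i + 1) • d - d = σ • (σ ^ i • d - d) + (σ • d - d) := by
        rw [pow_succ', mul_smul, smul_sub σ (σ ^ i • d) d]
        ring
      rw [this]
      exact J.add_mem (hJσ ih) hdJ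
  -- The sum telescopes to σⁿy − y = 0, while each term is d modulo higher order. So nd has order
  -- larger than d, which is absurd when n is a unit at q.
  have hsum : ∑ i ∈ Finset.range n, σ ^ i • d = 0 := by
    have : ∀ i, σ ^ i • d = σ ^ (i + 1) • y - σ ^ i • y := fun i => by
      rw [smul_sub, pow_succ, mul_smul]
    simp only [this, Finset.sum_range_sub (fun i => σ ^ i • y), hσn, pow_zero, one_smul, sub_self]
  have hnd : (n : A) * d ∈ J := by
    have h1 := J.sum_mem fun i (_ : i ∈ Finset.range n) => hi i
    rw [Finset.sum_sub_distrib, hsum, zero_sub, Finset.sum_const, Finset.card_range,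
      nsmul_eq_mul] at h1
    exact (Submodule.neg_mem_iff J).1 h1
  have hn0 : (n : A) ≠ 0 := fun h => hn (h ▸ q.zero_mem)
  rw [hJ _ (mul_ne_zero hn0 hd), hw.mul _ _ hn0 hd, (hw.eq_zero_iff _ hn0).2 hn] at hnd
  omega

end Tame

/-! ### Ramification indices. -/

section Ramification

open IsLocalRing

/-- The index e is the order in B of a uniformizer t of the smaller ring. Every x is a unit times a
power of t, so a single x of known order bounds e by divisibility. -/
theorem exists_map_eq_maximalIdeal_pow {A₁ B : Type*} [CommRing A₁] [CommRing B] [IsDomain A₁]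
    [IsDomain B] [Algebra A₁ B] [FaithfulSMul A₁ B] (Q : Ideal B) [Q.IsPrime]
    [IsDiscreteValuationRing (Localization.AtPrime Q)]
    [IsDiscreteValuationRing (Localization.AtPrime (Q.comap (algebraMap A₁ B)))]
    {v : B → ℕ} (hv : IsOrderAt Q v) {x : A₁} (hx : x ≠ 0) :
    ∃ e : ℕ, e ∣ v (algebraMap A₁ B x) ∧ (Q.comap (algebraMap A₁ B)).map
      ((algebraMap B (Localization.AtPrime Q)).comp (algebraMap A₁ B)) =
        maximalIdeal (Localization.AtPrime Q) ^ e := by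
  have h0 {a : A₁} (ha : a ≠ 0) : algebraMap A₁ B a ≠ 0 := by
    rwa [Ne, FaithfulSMul.algebraMap_eq_zero_iff]
  obtain ⟨w, hw⟩ := exists_isOrderAt (Q.comap (algebraMap A₁ B))
  obtain ⟨t, ht, ht1⟩ := hw.exists_eq_one
  obtain ⟨u, hu, hu1⟩ := hv.exists_eq_one
  have hspan {y z : B} (h : ∃ s ∉ Q, ∃ a, s * z = a * y) :
      algebraMap B (Localization.AtPrime Q) y ∣ algebraMap B _ z :=
    (algebraMap_dvd_atPrime_iff Q y z).2 h
  have hmax : maximalIdeal (Localization.AtPrime Q) =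
      Ideal.span {algebraMap B (Localization.AtPrime Q) u} := by
    rw [← Localization.AtPrime.map_eq_maximalIdeal]
    refine le_antisymm (Ideal.map_le_iff_le_comap.2 fun z hz => ?_) ?_
    · rw [Ideal.mem_comap, Ideal.mem_span_singleton]
      by_cases hz0 : z = 0
      · rw [hz0, map_zero]
        exact dvd_zero _
      refine hspan ((hv.le_iff _ _ hu hz0).1 ?_)
      rw [hu1]
      exact (hv.pos_iff hz0).2 hz
    · rw [Ideal.span_singleton_le_iff_mem]
      exact Ideal.mem_map_of_mem _ ((hv.pos_iff hu).1 (by omega))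
  refine ⟨v (algebraMap A₁ B t), ?_, ?_⟩
  · obtain ⟨s, hs, c, hc, h⟩ := hw.exists_pow_associated ht ht1 hx
    have hs0 : s ≠ 0 := fun h => hs (h ▸ Ideal.zero_mem _)
    have hc0 : c ≠ 0 := fun h => hc (h ▸ Ideal.zero_mem _)
    have := congrArg (fun z => v (algebraMap A₁ B z)) h
    simp only [map_mul, map_pow] at this
    rw [hv.mul _ _ (h0 hs0) (h0 hx), hv.mul _ _ (h0 hc0) (pow_ne_zero _ (h0 ht)), hv.pow (h0 ht),
      (hv.eq_zero_iff _ (h0 hs0)).2 hs, (hv.eq_zero_iff _ (h0 hc0)).2 hc, zero_add,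
        zero_add] at this
    exact ⟨_, this.trans (mul_comm _ _)⟩
  · have hut : v (u ^ v (algebraMap A₁ B t)) = v (algebraMap A₁ B t) := by
      rw [hv.pow hu, hu1, mul_one]
    rw [hmax, Ideal.span_singleton_pow, ← map_pow]
    refine le_antisymm (Ideal.map_le_iff_le_comap.2 fun y hy => ?_) ?_
    · rw [Ideal.mem_comap, Ideal.mem_span_singleton, RingHom.comp_apply]
      by_cases hy0 : y = 0
      · rw [hy0, map_zero, map_zero]
        exact dvd_zero _
      obtain ⟨s, hs, a, h⟩ := (hw.le_iff t y ht hy0).1 (by rw [ht1]; exact (hw.pos_iff hy0).2 hy)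
      refine dvd_trans (b := algebraMap B _ (algebraMap A₁ B t)) ?_ ?_
      · exact hspan ((hv.le_iff _ _ (pow_ne_zero _ hu) (h0 ht)).1 hut.le)
      · exact hspan ⟨algebraMap A₁ B s, hs, algebraMap A₁ B a, by rw [← map_mul, h, map_mul]⟩
    · rw [Ideal.span_singleton_le_iff_mem]
      refine Ideal.mem_of_dvd _ (hspan ((hv.le_iff _ _ (h0 ht) (pow_ne_zero _ hu)).1 hut.ge)) ?_
      exact Ideal.mem_map_of_mem ((algebraMap B (Localization.AtPrime Q)).comp (algebraMap A₁ B))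
        ((hw.pos_iff ht).1 (by omega))

theorem ramificationIndex_eq_of_map_eq {A B : Type*} [CommRing A] [CommRing B] (f : A →+* B)
    (Q : Ideal B) [Q.IsPrime] [IsDomain B] [IsDiscreteValuationRing (Localization.AtPrime Q)]
    {e : ℕ} (h : (Q.comap f).map ((algebraMap B (Localization.AtPrime Q)).comp f) =
      maximalIdeal (Localization.AtPrime Q) ^ e) : ramificationIndex f Q = e := by
  let := f.toAlgebra
  have h1 : (Q.under A).map (algebraMap A (Localization.AtPrime Q)) =
    maximalIdeal (Localization.AtPrime Q) ^ e := h
  change Q.ramificationIdx A = e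
  have hdvr : IsDiscreteValuationRing (Localization.AtPrime Q) := inferInstance
  rw [Ideal.ramificationIdx_def, h1, hdvr.length_quotient_pow_maximalIdeal, ENat.toNat_natCast]

/-- An étale local map generates the maximal ideal of its target, so passing from A₀ to A₁ leaves
the ideal extended to the local ring at Q unchanged. -/
theorem map_comap_eq_of_isEtaleLocalHom.{u} {A₀ A₁ : Type u} {B : Type*} [CommRing A₀]
    [CommRing A₁] [CommRing B] (f : A₀ →+* A₁) (g : A₁ →+* B) (Q : Ideal B) [Q.IsPrime]
    (h : IsEtaleLocalHom (Localization.localRingHom ((Q.comap g).comap f) (Q.comap g) f rfl)) :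
    (Q.comap (g.comp f)).map ((algebraMap B (Localization.AtPrime Q)).comp (g.comp f)) =
      (Q.comap g).map ((algebraMap B (Localization.AtPrime Q)).comp g) := by
  have h1 := h.map_maximalIdeal
  rw [← Localization.AtPrime.map_eq_maximalIdeal, ← Localization.AtPrime.map_eq_maximalIdeal,
    Ideal.map_map] at h1
  have h2 := congrArg (Ideal.map (Localization.localRingHom (Q.comap g) Q g rfl)) h1
  rw [Ideal.map_map, Ideal.map_map] at h2
  convert! h2 using 2
  · ext a
    simp [Localization.localRingHom_to_map]
  · ext a
    simp [Localization.localRingHom_to_map]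

end Ramification

/-! ### Characters of finite commutative groups. -/

/-- When the order is invertible there are as many characters as elements, and Dedekind independence
makes them a basis of all functions. -/
theorem span_monoidHom_eq_top {S K : Type*} [Group S] [Finite S] [Field K] [IsAlgClosed K]
    (hcomm : ∀ a b : S, a * b = b * a) (hS : (Nat.card S : K) ≠ 0) :
    Submodule.span K (Set.range fun f : S →* K => (f : S → K)) = ⊤ := by
  let : CommGroup S := { mul_comm := hcomm }
  have := Fintype.ofFinite S
  have hexp : NeZero (Monoid.exponent S : K) := ⟨fun h => hS (by
    obtain ⟨c, hc⟩ := Group.exponent_dvd_nat_card (G := S)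
    rw [hc, Nat.cast_mul, h, zero_mul])⟩
  have hcard := CommGroup.card_monoidHom_of_hasEnoughRootsOfUnity S K
  have : Finite (S →* Kˣ) := Nat.finite_of_card_ne_zero (by rw [hcard]; exact Nat.card_pos.ne')
  have := Fintype.ofFinite (S →* Kˣ)
  have hinj : Function.Injective fun f : S →* Kˣ => (Units.coeHom K).comp f := fun f g h => by
    ext s
    exact DFunLike.congr_fun h s
  have hli := (linearIndependent_monoidHom S K).comp _ hinj
  have := hli.span_eq_top_of_card_eq_finrank' (by
    rw [Module.finrank_fintype_fun_eq_card, ← Nat.card_eq_fintype_card, hcard,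
      Nat.card_eq_fintype_card])
  rw [eq_top_iff, ← this, Submodule.span_le]
  rintro _ ⟨f, rfl⟩
  exact Submodule.subset_span ⟨_, rfl⟩

/-! ### The Zariski topology and the identity component. -/

namespace AffineAlgebraicGroup

variable {K G : Type*} [Field K] [Group G] (V : AffineAlgebraicGroup K G)

theorem eq_of_forall_regular {x y : G} (h : ∀ f ∈ V.regular, f x = f y) : x = y :=
  V.eval_bijective.1 (AlgHom.ext fun f => h f f.2)

/-- The point of the spectrum of the coordinate ring given by an element of the group. -/
def toPrimeSpectrum (g : G) : PrimeSpectrum V.regular :=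
  ⟨RingHom.ker ((Pi.evalAlgHom K (fun _ : G => K) g).comp V.regular.val), RingHom.ker_isPrime _⟩

theorem isInducing_toPrimeSpectrum :
    @Topology.IsInducing G (PrimeSpectrum V.regular) V.zariski _ V.toPrimeSpectrum := by
  let := V.zariski
  refine ⟨?_⟩
  rw [PrimeSpectrum.isTopologicalBasis_basic_opens.eq_generateFrom, induced_generateFrom_eq]
  refine congrArg TopologicalSpace.generateFrom (Set.ext fun U => ?_)
  constructor
  · rintro ⟨f, hf, rfl⟩
    exact ⟨_, ⟨⟨f, hf⟩, rfl⟩, rfl⟩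
  · rintro ⟨_, ⟨f, rfl⟩, rfl⟩
    exact ⟨f, f.2, rfl⟩

theorem exists_regular_of_notMem {Z : Set G} (hZ : @IsClosed G V.zariski Z) {g : G} (hg : g ∉ Z) :
    ∃ f ∈ V.regular, (∀ z ∈ Z, f z = 0) ∧ f g ≠ 0 := by
  let := V.zariski
  obtain ⟨U, hU, hUZ⟩ := V.isInducing_toPrimeSpectrum.isOpen_iff.1 hZ.isOpen_compl
  obtain ⟨_, ⟨f, rfl⟩, hfg, hfU⟩ :=
    PrimeSpectrum.isTopologicalBasis_basic_opens.exists_subset_of_mem_open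
    (show V.toPrimeSpectrum g ∈ U by rw [← Set.mem_preimage, hUZ]; exact hg) hU
  refine ⟨f, f.2, fun z hz => by_contra fun h => ?_, hfg⟩
  have : z ∈ Zᶜ := by
    rw [← hUZ]
    exact hfU h
  exact this hz

/-- By the Nullstellensatz, a maximal ideal containing both vanishing ideals would be a point of G
lying in both closed sets. The ideals are therefore comaximal. -/
theorem exists_regular_separating [IsAlgClosed K] {Z₁ Z₂ : Set G} (h₁ : @IsClosed G V.zariski Z₁)
    (h₂ : @IsClosed G V.zariski Z₂) (h : Disjoint Z₁ Z₂) :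
    ∃ f ∈ V.regular, (∀ z ∈ Z₁, f z = 1) ∧ ∀ z ∈ Z₂, f z = 0 := by
  let I (Z : Set G) : Ideal V.regular :=
    { carrier := {f | ∀ z ∈ Z, (f : G → K) z = 0}
      add_mem' := fun {a b} ha hb z hz => by simp [ha z hz, hb z hz]
      zero_mem' := fun z _ => rfl
      smul_mem' := fun c {x} hx z hz => by simp [hx z hz] }
  have htop : I Z₁ ⊔ I Z₂ = ⊤ := by
    by_contra hne
    obtain ⟨M, hM, hle⟩ := Ideal.exists_le_maximal _ hne
    have : Algebra.FiniteType K V.regular := V.regular.fg_iff_finiteType.1 V.finitelyGenerated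
    let := Ideal.Quotient.field M
    have : Module.Finite K (V.regular ⧸ M) := finite_of_finite_type_of_isJacobsonRing K _
    have : Algebra.IsIntegral K (V.regular ⧸ M) := Algebra.IsIntegral.of_finite K _
    have hbij := IsAlgClosed.algebraMap_bijective_of_isIntegral (k := K) (K := V.regular ⧸ M)
    let e := AlgEquiv.ofBijective (Algebra.ofId K (V.regular ⧸ M)) hbij
    obtain ⟨g, hg⟩ := V.eval_bijective.2 (e.symm.toAlgHom.comp (Ideal.Quotient.mkₐ K M))
    have hMg (f : V.regular) (hf : f ∈ M) : (f : G → K) g = 0 := by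
      have h1 := DFunLike.congr_fun hg f
      have h2 : e.symm (Ideal.Quotient.mk M f) = 0 := by
        rw [Ideal.Quotient.eq_zero_iff_mem.2 hf, map_zero]
      exact h1.trans h2
    have hmem {Z : Set G} (hZ : @IsClosed G V.zariski Z) (hle : I Z ≤ M) : g ∈ Z := by
      by_contra hgZ
      obtain ⟨f, hf, hfZ, hfg⟩ := V.exists_regular_of_notMem hZ hgZ
      exact hfg (hMg ⟨f, hf⟩ (hle hfZ))
    exact Set.disjoint_left.1 h (hmem h₁ (le_sup_left.trans hle)) (hmem h₂ (le_sup_right.trans hle))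
  obtain ⟨a, ha, b, hb, hab⟩ := Submodule.mem_sup.1 ((Ideal.eq_top_iff_one _).1 htop)
  have hab' (z : G) : (a : G → K) z + (b : G → K) z = 1 :=
    congrFun (congrArg Subtype.val hab) z
  exact ⟨b, b.2, fun z hz => by rw [← hab' z, ha z hz, zero_add], hb⟩

/-- The group is a Noetherian space, so it has finitely many irreducible components. Sending a coset
to the component of a representative is injective, because that component stays inside the coset. -/
instance finiteIndex_identityComponent : V.identityComponent.FiniteIndex := by
  let := V.zariski
  have : Algebra.FiniteType K V.regular := V.regular.fg_iff_finiteType.1 V.finitelyGenerated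
  have : IsNoetherianRing V.regular := Algebra.FiniteType.isNoetherianRing K _
  have := V.isInducing_toPrimeSpectrum.noetherianSpace
  have : Finite (irreducibleComponents G) :=
    TopologicalSpace.NoetherianSpace.finite_irreducibleComponents
  have hinj : Function.Injective fun c : G ⧸ V.identityComponent =>
      (⟨_, irreducibleComponent_mem_irreducibleComponents c.out⟩ : irreducibleComponents G) := by
    intro c d hcd
    have h1 : irreducibleComponent c.out = irreducibleComponent d.out := congrArg Subtype.val hcd
    have h2 : d.out ∈ connectedComponent c.out :=
      irreducibleComponent_subset_connectedComponent (h1 ▸ mem_irreducibleComponent)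
    rw [← QuotientGroup.out_eq' c, ← QuotientGroup.out_eq' d]
    refine QuotientGroup.eq.2 ?_
    have hc : IsPreconnected ((fun x => c.out⁻¹ * x) '' connectedComponent c.out) :=
      isPreconnected_connectedComponent.image _ (V.continuous_of_regular _ fun f hf =>
        V.regular_mul_left hf _).continuousOn
    exact hc.subset_connectedComponent ⟨c.out, mem_connectedComponent, inv_mul_cancel _⟩
      ⟨d.out, h2, rfl⟩
  have := Finite.of_injective _ hinj
  exact Subgroup.finiteIndex_of_finite_quotient

theorem isClosed_of_mul_mem (hT : V.IsClosedSubgroup V.identityComponent) {Z : Set G}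
    (hZ : ∀ z ∈ Z, ∀ t ∈ V.identityComponent, z * t ∈ Z) : @IsClosed G V.zariski Z := by
  let := V.zariski
  have : Z = ⋃ c ∈ (QuotientGroup.mk '' Z : Set (G ⧸ V.identityComponent)),
      (fun x => c.out⁻¹ * x) ⁻¹' (V.identityComponent : Set G) := by
    ext z
    simp only [Set.mem_iUnion, Set.mem_preimage, SetLike.mem_coe]
    have hmk (c : G ⧸ V.identityComponent) (z : G) :
        c.out⁻¹ * z ∈ V.identityComponent ↔ c = (z : G ⧸ V.identityComponent) := by
      rw [← QuotientGroup.eq, QuotientGroup.out_eq']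
    simp only [hmk]
    constructor
    · intro hz
      exact ⟨z, ⟨z, hz, rfl⟩, rfl⟩
    · rintro ⟨_, ⟨y, hy, rfl⟩, h⟩
      simpa using hZ y hy _ (QuotientGroup.eq.1 h)
  rw [this]
  exact (Set.toFinite _).isClosed_biUnion fun c _ =>
    hT.preimage (V.continuous_of_regular _ fun f hf => V.regular_mul_left hf _)

theorem exists_regular_eq_indicator [IsAlgClosed K]
    (hT : V.IsClosedSubgroup V.identityComponent) (g : G) : ∃ f ∈ V.regular,
      (∀ x, x⁻¹ * g ∈ V.identityComponent → f x = 1) ∧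
        ∀ x, x⁻¹ * g ∉ V.identityComponent → f x = 0 := by
  have key (z t : G) (ht : t ∈ V.identityComponent) :
      (z * t)⁻¹ * g ∈ V.identityComponent ↔ z⁻¹ * g ∈ V.identityComponent := by
    rw [mul_inv_rev, mul_assoc]
    exact V.identityComponent.mul_mem_cancel_left (V.identityComponent.inv_mem ht)
  exact V.exists_regular_separating
    (Z₁ := {x | x⁻¹ * g ∈ V.identityComponent}) (Z₂ := {x | x⁻¹ * g ∉ V.identityComponent})
    (V.isClosed_of_mul_mem hT fun z hz t ht => (key z t ht).2 hz)
    (V.isClosed_of_mul_mem hT fun z hz t ht => fun h => hz ((key z t ht).1 h))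
    (Set.disjoint_left.2 fun z hz hz' => hz' hz)

/-! ### Tori. -/

section Torus

variable {V} {T : Subgroup G} (hT : V.IsTorus T)
include hT

theorem IsTorus.exists_pow_eq [IsAlgClosed K] {n : ℕ} (hn : 0 < n) {t : G} (ht : t ∈ T) :
    ∃ s ∈ T, s ^ n = t := by
  obtain ⟨-, r, φ, -⟩ := hT
  have (i : Fin r) : ∃ u : Kˣ, u ^ n = φ ⟨t, ht⟩ i := by
    obtain ⟨z, hz⟩ := IsAlgClosed.exists_pow_nat_eq ((φ ⟨t, ht⟩ i : Kˣ) : K) hn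
    have hz0 : z ≠ 0 := by
      rintro rfl
      rw [zero_pow hn.ne'] at hz
      exact (φ ⟨t, ht⟩ i).ne_zero hz.symm
    exact ⟨Units.mk0 z hz0, Units.ext (by simpa using hz)⟩
  choose u hu using this
  refine ⟨φ.symm u, (φ.symm u).2, ?_⟩
  have : (φ.symm u) ^ n = ⟨t, ht⟩ := φ.injective (by
    rw [map_pow, MulEquiv.apply_symm_apply]
    exact funext hu)
  exact congrArg Subtype.val this

theorem IsTorus.finite_pow_eq_one {n : ℕ} (hn : 0 < n) : {t | t ∈ T ∧ t ^ n = 1}.Finite := by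
  obtain ⟨-, r, φ, -⟩ := hT
  have : NeZero n := ⟨hn.ne'⟩
  let ψ (t : {t | t ∈ T ∧ t ^ n = 1}) (i : Fin r) : rootsOfUnity n K :=
    ⟨φ ⟨t.1, t.2.1⟩ i, by
      rw [mem_rootsOfUnity]
      have : φ ⟨t.1, t.2.1⟩ ^ n = 1 := by
        rw [← map_pow, show (⟨t.1, t.2.1⟩ : T) ^ n = 1 from Subtype.ext t.2.2, map_one]
      exact congrFun this i⟩
  have : Finite {t | t ∈ T ∧ t ^ n = 1} := Finite.of_injective ψ fun t t' h => by
    have h1 : φ ⟨t.1, t.2.1⟩ = φ ⟨t'.1, t'.2.1⟩ :=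
      funext fun i => congrArg Subtype.val (congrFun h i)
    exact Subtype.ext (congrArg (Subtype.val : T → G) (φ.injective h1))
  exact Set.toFinite _

/-- Each coordinate character is an eigenvector of translation by t on the torus, with eigenvalue
its value at t. Unipotence forces that value to be 1. -/
theorem IsTorus.eq_one_of_isUnipotent {t : G} (ht : t ∈ T) (hu : V.IsUnipotent t) : t = 1 := by
  obtain ⟨-, r, φ, hφ⟩ := hT
  have : (⟨t, ht⟩ : T) = 1 := φ.injective (by
    rw [map_one]
    funext i
    have hmem : (fun s : T => ((φ s i : Kˣ) : K)) ∈ V.regularOn T := by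
      rw [hφ]
      exact Algebra.subset_adjoin (Or.inl ⟨i, rfl⟩)
    obtain ⟨f, hf, hfi⟩ := hmem
    have hfi' (s : T) : f s = φ s i := congrFun hfi s
    obtain ⟨n, hn⟩ := hu f hf
    have key (m : ℕ) (s : T) : ((LinearMap.funLeft K K (fun x : G => x * t) - 1) ^ m) f s =
        (((φ ⟨t, ht⟩ i : Kˣ) : K) - 1) ^ m * φ s i := by
      induction m generalizing s with
      | zero => simpa using hfi' s
      | succ m ih =>
        have h1 := ih (s * ⟨t, ht⟩)
        rw [Subgroup.coe_mul] at h1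
        rw [pow_succ', Module.End.mul_apply, LinearMap.sub_apply, Pi.sub_apply,
          LinearMap.funLeft_apply, Module.End.one_apply, h1, ih s, map_mul, Pi.mul_apply,
          Units.val_mul]
        ring
    have h0 := key n 1
    rw [hn, map_one] at h0
    rw [Pi.one_apply, Units.val_one, mul_one] at h0
    exact Units.ext (sub_eq_zero.1 (eq_zero_of_pow_eq_zero h0.symm)))
  exact congrArg Subtype.val this

end Torus

end AffineAlgebraicGroup

/-! ### Unipotent elements modulo a central torus. -/

theorem Polynomial.X_sub_one_pow_expChar_pow {K : Type*} [Field K] (q : ℕ) [ExpChar K q] (a : ℕ) :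
    (Polynomial.X - 1 : Polynomial K) ^ q ^ a = Polynomial.X ^ q ^ a - 1 := by
  have : ExpChar (Polynomial K) q := inferInstance
  rw [sub_pow_expChar_pow, one_pow]

namespace AffineAlgebraicGroup

variable {K G : Type*} [Field K] [Group G] {V : AffineAlgebraicGroup K G}

/-- Right translation of functions by `σ`. -/
abbrev rightTranslation (K : Type*) [Field K] (σ : G) : Module.End K (G → K) :=
  LinearMap.funLeft K K fun x : G => x * σ

theorem rightTranslation_pow_apply (σ : G) (n : ℕ) (f : G → K) (x : G) :
    (rightTranslation K σ ^ n) f x = f (x * σ ^ n) := by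
  induction n generalizing x with
  | zero => simp
  | succ n ih =>
    rw [pow_succ', Module.End.mul_apply, LinearMap.funLeft_apply, ih, pow_succ', mul_assoc]

theorem rightTranslation_pow (σ : G) (n : ℕ) :
    rightTranslation K σ ^ n = rightTranslation K (σ ^ n) :=
  LinearMap.ext fun f => funext fun x => rightTranslation_pow_apply σ n f x

theorem IsUnipotent.pow {σ : G} (h : V.IsUnipotent σ) (k : ℕ) : V.IsUnipotent (σ ^ k) := by
  intro f hf
  obtain ⟨n, hn⟩ := h f hf
  refine ⟨n, ?_⟩
  change ((rightTranslation K (σ ^ k) - 1) ^ n) f = 0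
  change ((rightTranslation K σ - 1) ^ n) f = 0 at hn
  have hc : Commute (∑ i ∈ Finset.range k, rightTranslation K σ ^ i) (rightTranslation K σ - 1) :=
    Commute.sum_left _ _ _ fun i _ =>
      ((Commute.refl _).pow_left i).sub_right (Commute.one_right _)
  rw [← rightTranslation_pow, ← geom_sum_mul, hc.mul_pow, Module.End.mul_apply, hn, map_zero]

/-- Translation by σ is annihilated on f by both Xⁿ − 1 and (X − 1)^N. As n is invertible, 1 is a
simple root of the former, so their greatest common divisor is X − 1. -/
theorem IsUnipotent.eq_one_of_pow_eq_one {σ : G} (h : V.IsUnipotent σ) {n : ℕ} (hn : (n : K) ≠ 0)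
    (hσ : σ ^ n = 1) : σ = 1 := by
  open Polynomial in
  have key : ∀ f ∈ V.regular, rightTranslation K σ f = f := by
    intro f hf
    obtain ⟨N, hN⟩ := h f hf
    change ((rightTranslation K σ - 1) ^ N) f = 0 at hN
    let S : K[X] := ∑ i ∈ Finset.range n, X ^ i
    have hS : S * (X - 1) = X ^ n - 1 := geom_sum_mul X n
    have hcop : IsCoprime S ((X - 1) ^ N) := by
      refine IsCoprime.pow_right (IsCoprime.symm ?_)
      rw [← C_1]
      refine (irreducible_X_sub_C (1 : K)).coprime_iff_not_dvd.2 fun h => hn ?_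
      rw [dvd_iff_isRoot, IsRoot.def] at h
      simpa [S, eval_finsetSum] using h
    obtain ⟨a, b, hab⟩ := hcop
    have h1 : (X - 1 : K[X]) = a * (X ^ n - 1) + (X - 1) * b * (X - 1) ^ N := by
      rw [← hS]
      linear_combination -(X - 1) * hab
    have h2 := congrArg (fun P : K[X] => aeval (rightTranslation K σ) P f) h1
    have h3 : (rightTranslation K σ ^ n) f = f := by
      funext x
      rw [rightTranslation_pow_apply, hσ, mul_one]
    simp only [map_add, map_mul, map_sub, map_pow, aeval_X, map_one, LinearMap.add_apply,
      Module.End.mul_apply, LinearMap.sub_apply, Module.End.one_apply, h3, hN, sub_self, map_zero,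
      add_zero] at h2
    exact sub_eq_zero.1 h2
  refine V.eq_of_forall_regular fun f hf => ?_
  simpa using congrFun (key f hf) 1

theorem isUnipotent_of_pow_expChar_pow_eq_one (q : ℕ) [ExpChar K q] {a : ℕ} {σ : G}
    (h : σ ^ q ^ a = 1) : V.IsUnipotent σ := by
  intro f _
  refine ⟨q ^ a, ?_⟩
  have h1 := congrArg (fun P : Polynomial K => Polynomial.aeval (rightTranslation K σ) P f)
    (Polynomial.X_sub_one_pow_expChar_pow (K := K) q a)
  simp only [map_sub, map_pow, Polynomial.aeval_X, map_one] at h1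
  refine h1.trans ?_
  rw [rightTranslation_pow, h]
  ext x
  simp [LinearMap.funLeft]

theorem IsUnipotent.pow_expChar_pow_eq_one {T : Subgroup G} (hT : V.IsTorus T) {q a n : ℕ}
    (hn : (n : K) ≠ 0) {σ : G} (hσ : σ ^ (q ^ a * n) ∈ T) (h : V.IsUnipotent σ) :
    σ ^ q ^ a = 1 := by
  refine (h.pow (q ^ a)).eq_one_of_pow_eq_one hn ?_
  rw [← pow_mul]
  exact hT.eq_one_of_isUnipotent hσ (h.pow _)

theorem exists_index_eq_expChar_pow_mul (q : ℕ) [ExpChar K q] {n : ℕ} (hn : n ≠ 0) :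
    ∃ a m : ℕ, n = q ^ a * m ∧ (m : K) ≠ 0 := by
  rcases ‹ExpChar K q› with _ | hq
  · exact ⟨0, n, by simp, by exact_mod_cast hn⟩
  · obtain ⟨a, m, hm, h⟩ := Nat.exists_eq_pow_mul_and_not_dvd hn q hq.ne_one
    exact ⟨a, m, h, fun h0 => hm ((CharP.cast_eq_zero_iff K q m).1 h0)⟩

/-- A group generated by unipotent elements in a group with central torus of finite index is
finite. -/
theorem finite_unipotentClosure [IsAlgClosed K] {T : Subgroup G} [T.FiniteIndex] (hT : V.IsTorus T)
    (hc : T ≤ Subgroup.center G) (S : Subgroup G) :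
    Finite (V.unipotentClosure S) := by
  have hnorm : T.Normal := ⟨fun t ht g => by
    rwa [Subgroup.mem_center_iff.1 (hc ht) g, mul_inv_cancel_right]⟩
  have hpow (g : G) : g ^ T.index ∈ T := Subgroup.pow_index_mem T g
  have : (Subgroup.center G).FiniteIndex := Subgroup.finiteIndex_of_le hc
  let c := (Subgroup.center G).index
  -- Transfer to the centre makes a power map into a homomorphism. It kills unipotents, since their
  -- images are unipotent elements of the torus. Hence U ∩ T consists of torsion of bounded order
  -- and is finite.
  let ψ : G →* Subgroup.center G := MonoidHom.mk'
    (fun g => MonoidHom.transferCenterPow G g ^ T.index) fun g h => by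
      rw [map_mul]
      exact Commute.mul_pow (Subtype.ext (Subgroup.mem_center_iff.1 (Subtype.prop _) _)) _
  have hψ (g : G) : (ψ g : G) = (g ^ c) ^ T.index := by
    simp [ψ, c]
  have hle : V.unipotentClosure S ≤ ψ.ker := by
    refine (Subgroup.closure_le _).2 fun σ hσ => ?_
    have h1 : (ψ σ : G) = 1 := by
      rw [hψ, ← pow_mul]
      refine hT.eq_one_of_isUnipotent ?_ (hσ.2.pow _)
      rw [pow_mul]
      exact hpow _
    exact Subtype.ext h1
  have hfin : (T.subgroupOf (V.unipotentClosure S) : Set (V.unipotentClosure S)).Finite := by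
    have hn : 0 < c * T.index := Nat.pos_of_ne_zero
      (mul_ne_zero Subgroup.FiniteIndex.index_ne_zero Subgroup.FiniteIndex.index_ne_zero)
    refine Set.Finite.of_finite_image ((hT.finite_pow_eq_one hn).subset ?_)
      Subtype.val_injective.injOn
    rintro _ ⟨g, hg, rfl⟩
    refine ⟨hg, ?_⟩
    rw [pow_mul, ← hψ, show ψ g = 1 from hle g.2]
    rfl
  have h1 : Finite (T.subgroupOf (V.unipotentClosure S)) := hfin
  have h2 : Finite (V.unipotentClosure S ⧸ T.subgroupOf (V.unipotentClosure S)) := inferInstance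
  exact Finite.of_subgroup_quotient (T.subgroupOf (V.unipotentClosure S))

/-- Every element of finite order modulo the central torus agrees modulo the torus with an element
of the same order. -/
theorem exists_pow_eq_one_of_pow_mem [IsAlgClosed K] {T : Subgroup G} (hT : V.IsTorus T)
    (hc : T ≤ Subgroup.center G) {σ : G} {n : ℕ} (hn : 0 < n) (hσ : σ ^ n ∈ T) :
    ∃ t ∈ T, (σ * t) ^ n = 1 := by
  obtain ⟨s, hs, h⟩ := hT.exists_pow_eq hn hσ
  refine ⟨s⁻¹, T.inv_mem hs, ?_⟩
  have hcomm : Commute σ s⁻¹ := Subgroup.mem_center_iff.1 (hc (T.inv_mem hs)) σ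
  rw [hcomm.mul_pow, inv_pow, h, mul_inv_cancel]

theorem IsTorus.regularOn_le_span {T : Subgroup G} (hT : V.IsTorus T) {f : T → K}
    (hf : f ∈ V.regularOn T) :
    f ∈ Submodule.span K {χ : T → K | χ ∈ V.regularOn T ∧ ∃ ψ : T →* K, χ = ψ} := by
  obtain ⟨-, r, φ, hφ⟩ := hT
  rw [hφ, ← Subalgebra.mem_toSubmodule, Algebra.adjoin_eq_span] at hf
  refine Submodule.span_mono (t := {χ : T → K | χ ∈ V.regularOn T ∧ ∃ ψ : T →* K, χ = ψ})
    (fun χ hχ => ⟨?_, ?_⟩) hf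
  · rw [hφ]
    exact (Submonoid.closure_le (S := (Algebra.adjoin K _).toSubmonoid)).2
      Algebra.subset_adjoin hχ
  · induction hχ using Submonoid.closure_induction with
    | mem χ h =>
      rcases h with ⟨i, rfl⟩ | ⟨i, rfl⟩
      · exact ⟨(Units.coeHom K).comp ((Pi.evalMonoidHom _ i).comp φ.toMonoidHom), rfl⟩
      · exact ⟨(Units.coeHom K).comp (invMonoidHom.comp
          ((Pi.evalMonoidHom _ i).comp φ.toMonoidHom)), rfl⟩
    | one => exact ⟨1, rfl⟩
    | mul χ χ' _ _ h h' =>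
      obtain ⟨ψ, rfl⟩ := h
      obtain ⟨ψ', rfl⟩ := h'
      exact ⟨ψ * ψ', rfl⟩

/-! ### Diagonalizability of D. -/

/-- The group generated by the central torus and an element of order prime to the characteristic
modulo the torus is diagonalizable. -/
theorem exists_isDiagonalizable [IsAlgClosed K] (hT : V.IsTorus V.identityComponent)
    (hc : V.identityComponent ≤ Subgroup.center G) {σ : G} {n : ℕ} (hn : (n : K) ≠ 0)
    (hσ : σ ^ n ∈ V.identityComponent) :
    ∃ D : Subgroup G, V.IsDiagonalizable D ∧ V.identityComponent ≤ D ∧ σ ∈ D ∧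
      D ≤ V.identityComponent ⊔ Subgroup.zpowers σ ∧
      IsCyclic (D ⧸ V.identityComponent.subgroupOf D) := by
  classical
  let T := V.identityComponent
  let m := orderOf (σ : G ⧸ T)
  have hmn : m ∣ n := orderOf_dvd_of_pow_eq_one ((QuotientGroup.eq_one_iff _).2 hσ)
  have hmK : (m : K) ≠ 0 := by
    obtain ⟨k, rfl⟩ := hmn
    rw [Nat.cast_mul] at hn
    exact left_ne_zero_of_mul hn
  have hm0 : 0 < m := Nat.pos_of_ne_zero fun h => hmK (by rw [h, Nat.cast_zero])
  have hσm : σ ^ m ∈ T := (QuotientGroup.eq_one_iff _).1 (pow_orderOf_eq_one (σ : G ⧸ T))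
  -- Here m is the exact order of σ modulo T, so the corrected element τ generates a complement to
  -- T, and D is the direct product of T and ⟨τ⟩.
  obtain ⟨t₀, ht₀, hτ⟩ := exists_pow_eq_one_of_pow_mem hT hc hm0 hσm
  let τ := σ * t₀
  have hmk : (τ : G ⧸ T) = σ := QuotientGroup.mk_mul_of_mem _ ht₀
  let S := Subgroup.zpowers τ
  have hSfin : Finite S := isOfFinOrder_iff_pow_eq_one.2 ⟨m, hm0, hτ⟩ |>.finite_zpowers
  have hST (s : G) (hs : s ∈ S) (hsT : s ∈ T) : s = 1 := by
    obtain ⟨i, rfl⟩ := Subgroup.mem_zpowers_iff.1 hs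
    have h1 : (σ : G ⧸ T) ^ i = 1 := by
      rw [← hmk, ← QuotientGroup.mk_zpow]
      exact (QuotientGroup.eq_one_iff _).2 hsT
    obtain ⟨k, rfl⟩ := orderOf_dvd_iff_zpow_eq_one.2 h1
    change τ ^ ((m : ℤ) * k) = 1
    rw [zpow_mul, zpow_natCast, hτ, one_zpow]
  have hScard : (Nat.card S : K) ≠ 0 := by
    rw [Nat.card_zpowers]
    obtain ⟨k, hk⟩ := orderOf_dvd_of_pow_eq_one hτ
    rw [hk, Nat.cast_mul] at hmK
    exact left_ne_zero_of_mul hmK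
  have hScomm (a b : S) : a * b = b * a := by
    obtain ⟨i, hi⟩ := Subgroup.mem_zpowers_iff.1 a.2
    obtain ⟨j, hj⟩ := Subgroup.mem_zpowers_iff.1 b.2
    refine Subtype.ext ?_
    change (a : G) * b = b * a
    rw [← hi, ← hj]
    exact zpow_mul_comm τ i j
  have hcomm (t : T) (s : S) : Commute (T.subtype t) (S.subtype s) :=
    (Subgroup.mem_center_iff.1 (hc t.2) s).symm
  let μ : T × S →* G := T.subtype.noncommCoprod S.subtype hcomm
  have hμ (t : T) (s : S) : μ (t, s) = t * s := rfl
  have hμinj : Function.Injective μ := by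
    rw [injective_iff_map_eq_one]
    rintro ⟨t, s⟩ h
    rw [hμ] at h
    have hs : (s : G) = 1 := hST s s.2 (by
      rw [eq_inv_of_mul_eq_one_right h]
      exact T.inv_mem t.2)
    rw [hs, mul_one] at h
    exact Prod.ext (Subtype.ext h) (Subtype.ext hs)
  let D := μ.range
  let e : T × S ≃* D := MonoidHom.ofInjective hμinj
  have he (d : D) : ((e.symm d).1 : G) * (e.symm d).2 = d := by
    have h1 := congrArg Subtype.val (e.apply_symm_apply d)
    exact h1
  have hmem (d : D) (s : S) : (d : G)⁻¹ * s ∈ T ↔ (e.symm d).2 = s := by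
    rw [← he d]
    generalize (e.symm d).1 = t
    generalize (e.symm d).2 = s'
    rw [show (t : G) * s' = s' * t from hcomm t s', mul_inv_rev, mul_assoc]
    change (t : G)⁻¹ * _ ∈ T ↔ _
    rw [T.mul_mem_cancel_left (T.inv_mem t.2)]
    constructor
    · intro h
      exact Subtype.ext (inv_mul_eq_one.1 (hST _ (S.mul_mem (S.inv_mem s'.2) s.2) h))
    · rintro rfl
      change (s' : G)⁻¹ * s' ∈ T
      rw [inv_mul_cancel]
      exact T.one_mem
  have hTD : T ≤ D := fun t ht => ⟨(⟨t, ht⟩, 1), by rw [hμ]; simp⟩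
  have hSD : S ≤ D := fun s hs => ⟨(1, ⟨s, hs⟩), by rw [hμ]; simp⟩
  have hclosed : V.IsClosedSubgroup D := V.isClosed_of_mul_mem hT.1 fun z hz t ht =>
    D.mul_mem hz (hTD ht)
  refine ⟨D, ⟨hclosed, ?_⟩, hTD, ?_, ?_, ?_⟩
  · let X : Submodule K (D → K) :=
      Submodule.span K {χ : D → K | χ ∈ V.regularOn D ∧ ∃ ψ : D →* K, χ = ψ}
    -- The cosets of T are separated by regular indicator functions, so a function given by regular
    -- functions coset by coset is regular on D.
    have hreg (f : D → K) (F : S → G → K) (hF : ∀ s, F s ∈ V.regular)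
        (h : ∀ d : D, f d = F (e.symm d).2 d) : f ∈ V.regularOn D := by
      choose ind hind h1 h0 using V.exists_regular_eq_indicator hT.1
      have := Fintype.ofFinite S
      refine ⟨∑ s : S, ind s * F s,
        V.regular.sum_mem fun s _ => V.regular.mul_mem (hind s) (hF s), ?_⟩
      funext d
      change (∑ s : S, ind s * F s) (d : G) = f d
      rw [h d, Finset.sum_apply, Finset.sum_eq_single_of_mem (e.symm d).2 (Finset.mem_univ _),
        Pi.mul_apply, h1, one_mul]
      · exact (hmem d _).2 rfl
      · intro s _ hs
        rw [Pi.mul_apply, h0 s d fun h => hs ((hmem d s).1 h).symm, zero_mul]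
    have hchar (θ : T →* K) (hθ : (θ : T → K) ∈ V.regularOn T) (ψ : S →* K) :
        (fun d : D => θ (e.symm d).1 * ψ (e.symm d).2) ∈ X := by
      obtain ⟨F, hF, hFθ⟩ := hθ
      have hFθ' (t : T) : F t = θ t := congrFun hFθ t
      refine Submodule.subset_span ⟨?_,
        ((θ.comp (MonoidHom.fst T S)) * (ψ.comp (MonoidHom.snd T S))).comp e.symm.toMonoidHom, rfl⟩
      refine hreg _ (fun s => ψ s • fun x => F (x * s⁻¹)) (fun s =>
        V.regular.smul_mem (V.regular_mul_right hF _) _) fun d => ?_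
      rw [Pi.smul_apply, smul_eq_mul, mul_comm, ← hFθ']
      congr 2
      exact eq_mul_inv_of_mul_eq (he d)
    have hprod (a : T → K) (ha : a ∈ V.regularOn T) (b : S → K) :
        (fun d : D => a (e.symm d).1 * b (e.symm d).2) ∈ X := by
      have ha' := hT.regularOn_le_span ha
      have hb' : b ∈ Submodule.span K (Set.range fun f : S →* K => (f : S → K)) := by
        rw [span_monoidHom_eq_top hScomm hScard]
        trivial
      let Φ : (T → K) →ₗ[K] (S → K) →ₗ[K] (D → K) := LinearMap.mk₂ K
        (fun a b d => a (e.symm d).1 * b (e.symm d).2)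
        (fun a a' b => funext fun d => add_mul _ _ _)
        (fun c a b => funext fun d => mul_assoc _ _ _)
        (fun a b b' => funext fun d => mul_add _ _ _)
        (fun c a b => funext fun d => mul_left_comm _ _ _)
      have h1 : Submodule.span K {χ : T → K | χ ∈ V.regularOn T ∧ ∃ ψ : T →* K, χ = ψ} ≤
          X.comap (Φ.flip b) := Submodule.span_le.2 (by
        rintro _ ⟨h, θ, rfl⟩
        have h2 : Submodule.span K (Set.range fun f : S →* K => (f : S → K)) ≤
            X.comap (Φ θ) := Submodule.span_le.2 (by
          rintro _ ⟨ψ, rfl⟩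
          exact hchar θ h ψ)
        exact h2 hb')
      exact h1 ha'
    rintro f ⟨F, hF, rfl⟩
    have := Fintype.ofFinite S
    have hFs (s : S) : (fun t : T => F (t * s)) ∈ V.regularOn T :=
      ⟨_, V.regular_mul_right hF s, rfl⟩
    -- A regular function is the sum over s in S of its translate restricted to T, times the delta
    -- function at s. Characters span both factors.
    have hsum := X.sum_mem fun s (_ : s ∈ Finset.univ) =>
      hprod _ (hFs s) (fun s' => if s' = s then 1 else 0)
    convert! hsum using 1
    funext d
    rw [Finset.sum_apply, Finset.sum_eq_single_of_mem (e.symm d).2 (Finset.mem_univ _)]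
    · rw [if_pos rfl, mul_one, he]
      rfl
    · intro s _ hs
      rw [if_neg hs.symm, mul_zero]
  · have h1 : τ * t₀⁻¹ ∈ D :=
      D.mul_mem (hSD (Subgroup.mem_zpowers τ)) (D.inv_mem (hTD ht₀))
    rwa [mul_inv_cancel_right] at h1
  · rintro _ ⟨⟨t, s⟩, rfl⟩
    refine Subgroup.mul_mem _ (Subgroup.mem_sup_left t.2) ?_
    refine (Subgroup.zpowers_le.2 ?_ : S ≤ _) s.2
    exact Subgroup.mul_mem _ (Subgroup.mem_sup_right (Subgroup.mem_zpowers σ))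
      (Subgroup.mem_sup_left ht₀)
  · refine isCyclic_of_surjective
      ((QuotientGroup.mk' (T.subgroupOf D)).comp (Subgroup.inclusion hSD)) fun c => ?_
    obtain ⟨⟨_, ⟨t, s⟩, rfl⟩, rfl⟩ := QuotientGroup.mk_surjective c
    refine ⟨s, QuotientGroup.eq.2 ?_⟩
    rw [Subgroup.mem_subgroupOf]
    change (s : G)⁻¹ * (t * s) ∈ T
    rw [show (t : G) * s = s * t from hcomm t s]
    simp

end AffineAlgebraicGroup

/-! ### Application to rings of invariants. -/

theorem isEtaleLocalHom_of_fixed.{u} {A₀ A₁ : Type u} {A Γ : Type*} (k : Type*) [Field k]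
    [Infinite k] [CommRing A₀] [CommRing A₁] [CommRing A] [IsDomain A] [Algebra k A] [Group Γ]
    [Finite Γ] [MulSemiringAction Γ A] [SMulCommClass Γ k A] (f : A₀ →+* A₁) (g : A₁ →+* A)
    (hf : Function.Injective f) (hg : Function.Injective g)
    (hΓ : ∀ a : A, a ∈ Set.range (g.comp f) ↔ ∀ σ : Γ, σ • a = a) (q : Ideal A) [q.IsPrime]
    (hI : ∀ a : A, a ∈ Set.range g ↔ ∀ σ ∈ q.inertia Γ, σ • a = a) :
    IsEtaleLocalHom (Localization.localRingHom ((q.comap g).comap f) (q.comap g) f rfl) := by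
  let := f.toAlgebra
  let := g.toAlgebra
  let := (g.comp f).toAlgebra
  have : IsScalarTower A₀ A₁ A := .of_algebraMap_eq fun _ => rfl
  have : FaithfulSMul A₁ A := (faithfulSMul_iff_algebraMap_injective _ _).2 hg
  have : FaithfulSMul A₀ A := (faithfulSMul_iff_algebraMap_injective _ _).2 (hg.comp hf)
  obtain ⟨x, hx, hxq⟩ := exists_fixed_smul_sub_notMem k (Γ := Γ) q
  obtain ⟨y, rfl⟩ := (hI x).2 hx
  obtain ⟨d, hd, het⟩ := exists_etale_away hΓ (q.inertia Γ) hI q y hxq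
  exact isEtaleLocalHom_localRingHom_of_etale_away (q.comap g) hd het

section FixedBySubgroup

variable {B A Γ : Type*} [CommRing B] [CommRing A] [IsDomain A] [Group Γ] [Finite Γ]
  [MulSemiringAction Γ A] {g : B →+* A} (hg : Function.Injective g) {H : Subgroup Γ}
  (hH : ∀ a : A, a ∈ Set.range g ↔ ∀ σ ∈ H, σ • a = a) (q : Ideal A) [q.IsPrime]
include hg hH

theorem height_comap_eq_one_of_fixed_by_subgroup (hq : q.height = 1) :
    (q.comap g).height = 1 := by
  let := g.toAlgebra
  have : FaithfulSMul B A := (faithfulSMul_iff_algebraMap_injective _ _).2 hg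
  exact height_comap_eq_one_of_fixed (B := B) (N := H)
    (fun a => (hH a).trans ⟨fun h σ => h σ σ.2, fun h σ hσ => h ⟨σ, hσ⟩⟩) q hq

theorem exists_mul_eq_of_fixed_by_subgroup (hHq : H ≤ q.inertia Γ) {x y : B} (hx : x ≠ 0)
    (h : ∃ s ∉ q, ∃ a, s * g y = a * g x) : ∃ s ∉ q.comap g, ∃ a, s * y = a * x := by
  let := g.toAlgebra
  have : FaithfulSMul B A := (faithfulSMul_iff_algebraMap_injective _ _).2 hg
  exact exists_mul_eq_of_fixed (B := B) (N := H)
    (fun a => (hH a).trans ⟨fun h σ => h σ σ.2, fun h σ hσ => h ⟨σ, hσ⟩⟩) q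
    (fun σ a => (smul_mem_iff_of_mem_inertia (hHq σ.2) a).1) hx h

theorem isDiscreteValuationRing_atPrime_of_fixed_by_subgroup [IsDomain B] (hq : q ≠ ⊥)
    (hHq : H ≤ q.inertia Γ) [IsDiscreteValuationRing (Localization.AtPrime q)] :
    IsDiscreteValuationRing (Localization.AtPrime (q.comap g)) := by
  let := g.toAlgebra
  have : FaithfulSMul B A := (faithfulSMul_iff_algebraMap_injective _ _).2 hg
  exact isDiscreteValuationRing_atPrime_of_fixed (B := B) (N := H)
    (fun a => (hH a).trans ⟨fun h σ => h σ σ.2, fun h σ hσ => h ⟨σ, hσ⟩⟩) q hq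
    (fun σ a => (smul_mem_iff_of_mem_inertia (hHq σ.2) a).1)

end FixedBySubgroup

section Invariants

variable {K : Type*} [Field K] {G : Type*} [Group G] {R : Type*} [CommRing R] [Algebra K R]
  [MulSemiringAction G R] [SMulCommClass G K R] {N : Subgroup G} [N.Normal]

theorem mem_range_invariantsInclusion_iff {S : Subgroup G} (h : N ≤ S) (a : invariants K R N) :
    a ∈ Set.range (invariantsInclusion K R h) ↔
      ∀ σ ∈ S.map (QuotientGroup.mk' N), σ • a = a := by
  constructor
  · rintro ⟨b, rfl⟩ _ ⟨σ, hσ, rfl⟩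
    exact Subtype.ext (b.2 ⟨σ, hσ⟩)
  · intro ha
    exact ⟨⟨a, fun σ => congrArg Subtype.val (ha _ ⟨σ, σ.2, rfl⟩)⟩, rfl⟩

omit [N.Normal] in
theorem invariantsInclusion_injective {S : Subgroup G} (h : N ≤ S) :
    Function.Injective (invariantsInclusion K R h) :=
  Subalgebra.inclusion_injective _

theorem map_mk_le_inertia {q : Ideal (invariants K R N)} {S : Subgroup G}
    (hS : S ≤ inertiaGroup q) : S.map (QuotientGroup.mk' N) ≤ q.inertia (G ⧸ N) :=
  Subgroup.map_le_iff_le_comap.2 hS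

theorem height_comap_invariantsInclusion [IsDomain R] [N.FiniteIndex] {S : Subgroup G} (h : N ≤ S)
    (q : Ideal (invariants K R N)) [q.IsPrime] (hq : q.height = 1) :
    (q.comap (invariantsInclusion K R h)).height = 1 := by
  refine height_comap_eq_one_of_fixed_by_subgroup (Γ := G ⧸ N) (invariantsInclusion_injective h)
    (H := S.map (QuotientGroup.mk' N)) ?_ q hq
  exact mem_range_invariantsInclusion_iff h

theorem isDiscreteValuationRing_invariants [IsDomain R] [N.FiniteIndex]
    (q : Ideal (invariants K R N)) [q.IsPrime] (hq : q ≠ ⊥)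
    [IsDiscreteValuationRing (Localization.AtPrime q)] {S : Subgroup G} (h : N ≤ S)
    (hS : S ≤ inertiaGroup q) :
    IsDiscreteValuationRing (Localization.AtPrime (q.comap (invariantsInclusion K R h))) := by
  refine isDiscreteValuationRing_atPrime_of_fixed_by_subgroup (Γ := G ⧸ N)
    (invariantsInclusion_injective h) (H := S.map (QuotientGroup.mk' N)) ?_ q hq
    (map_mk_le_inertia hS)
  exact mem_range_invariantsInclusion_iff h

theorem exists_mul_eq_of_le_inertiaGroup [IsDomain R] [N.FiniteIndex]
    (q : Ideal (invariants K R N)) [q.IsPrime] {S : Subgroup G} (h : N ≤ S)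
    (hS : S ≤ inertiaGroup q) {x y : invariants K R S} (hx : x ≠ 0)
    (hxy : ∃ s ∉ q, ∃ a, s * invariantsInclusion K R h y = a * invariantsInclusion K R h x) :
    ∃ s ∉ q.comap (invariantsInclusion K R h), ∃ a, s * y = a * x := by
  refine exists_mul_eq_of_fixed_by_subgroup (Γ := G ⧸ N) (invariantsInclusion_injective h)
    (H := S.map (QuotientGroup.mk' N)) ?_ q (map_mk_le_inertia hS) hx hxy
  exact mem_range_invariantsInclusion_iff h

-- The quotient in R of two invariants is itself invariant by cancellation; this is the saturation A
-- = R ∩ Frac A.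
omit [N.Normal] in
theorem IsKrullDomain.isDiscreteValuationRing_invariants (hR : IsKrullDomain R) [IsDomain R]
    (q : Ideal (invariants K R N)) [q.IsPrime] (hq : q.height = 1) :
    IsDiscreteValuationRing (Localization.AtPrime q) := by
  have : FaithfulSMul (invariants K R N) R :=
    (faithfulSMul_iff_algebraMap_injective _ _).2 Subtype.val_injective
  refine hR.isDiscreteValuationRing_of_saturated (fun x y hx => ?_) q hq
  rintro ⟨c, hc⟩
  have hx' : (x : R) ≠ 0 := fun h => hx (Subtype.ext h)
  have hc' : (y : R) = x * c := hc
  refine ⟨⟨c, fun σ => mul_left_cancel₀ hx' ?_⟩, Subtype.ext hc⟩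
  have h1 := congrArg (σ • ·) hc'
  simp only [smul_mul', x.2 σ, y.2 σ] at h1
  rw [← h1, hc']

theorem isEtaleLocalHom_invariants [Infinite K] [IsDomain R] [N.FiniteIndex]
    (q : Ideal (invariants K R N)) [q.IsPrime] :
    IsEtaleLocalHom (Localization.localRingHom
      ((q.comap (invariantsInclusion K R (le_inertiaGroup q))).comap
        (invariantsInclusion K R (le_top : inertiaGroup q ≤ ⊤)))
      (q.comap (invariantsInclusion K R (le_inertiaGroup q)))
      (invariantsInclusion K R (le_top : inertiaGroup q ≤ ⊤)) rfl) := by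
  refine isEtaleLocalHom_of_fixed K (Γ := G ⧸ N) _ _ (Subalgebra.inclusion_injective _)
    (invariantsInclusion_injective _) (fun a => ?_) q fun a => ?_
  · refine (mem_range_invariantsInclusion_iff (le_top : N ≤ ⊤) a).trans
      ⟨fun h σ => h σ ?_, fun h σ _ => h σ⟩
    obtain ⟨σ, rfl⟩ := QuotientGroup.mk_surjective σ
    exact ⟨σ, trivial, rfl⟩
  · refine (mem_range_invariantsInclusion_iff (le_inertiaGroup q) a).trans
      ⟨fun h σ hσ => h σ ?_, fun h σ hσ => h σ (map_mk_le_inertia le_rfl hσ)⟩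
    obtain ⟨σ, rfl⟩ := QuotientGroup.mk_surjective σ
    exact ⟨σ, hσ, rfl⟩

theorem restrictionHom_eq_iff (σ τ : G) :
    restrictionHom K R N σ = restrictionHom K R N τ ↔ ∀ x ∈ invariants K R N, σ • x = τ • x := by
  refine ⟨fun h x hx => ?_, fun h => Equiv.ext fun x => Subtype.ext (h x x.2)⟩
  have h1 := DFunLike.congr_fun h (⟨x, hx⟩ : invariants K R N)
  exact congrArg Subtype.val h1

theorem invariants_le_of_map_le {S T : Subgroup G} (hT : N ≤ T)
    (h : S.map (restrictionHom K R N) ≤ T.map (restrictionHom K R N)) :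
    invariants K R T ≤ invariants K R S := by
  intro x hx σ
  obtain ⟨τ, hτ, e⟩ := h ⟨σ, σ.2, rfl⟩
  have := (restrictionHom_eq_iff (K := K) τ σ).1 e x (invariants_anti K R hT hx)
  exact this.symm.trans (hx ⟨τ, hτ⟩)

end Invariants

/-! ### Group theory of a tame character. -/

theorem Nat.coprime_expChar_of_cast_ne_zero {K : Type*} [Field K] (ℓ : ℕ) [hℓ : ExpChar K ℓ] {n : ℕ}
    (hn : (n : K) ≠ 0) : ℓ.Coprime n := by
  rcases hℓ with _ | hℓ
  · exact Nat.coprime_one_left n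
  · exact (hℓ.coprime_iff_not_dvd).2 fun h => hn ((CharP.cast_eq_zero_iff K ℓ n).2 h)

theorem Units.eq_one_of_pow_expChar_pow_eq_one {κ : Type*} [Field κ] (ℓ : ℕ) [ExpChar κ ℓ] {k : ℕ}
    {u : κˣ} (h : u ^ ℓ ^ k = 1) : u = 1 := by
  refine Units.ext (iterateFrobenius_inj κ ℓ k ?_)
  simpa [iterateFrobenius_def] using congrArg Units.val h

section TameCharacter

variable {K G X κ : Type*} [Field K] [Group G] [Group X] [Field κ] (ℓ : ℕ) [ExpChar K ℓ]
  [ExpChar κ ℓ] {T I : Subgroup G} {ρ : G →* X} {χ : I →* κˣ} {a n : ℕ} (hn : (n : K) ≠ 0)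
  (hpow : ∀ σ : G, σ ^ (ℓ ^ a * n) ∈ T)
include hn hpow

theorem exists_pow_mem_and_forall_map_mul_zpow_eq_one
    (hT : ∀ σ : I, (σ : G) ∈ T → χ σ = 1) :
    ∃ σ : I, (σ : G) ^ n ∈ T ∧ ∀ τ : I, ∃ i : ℤ, χ (τ * σ ^ i) = 1 := by
  have hn0 : n ≠ 0 := by
    rintro rfl
    exact hn Nat.cast_zero
  have hχ (τ : I) : χ τ ^ n = 1 := by
    refine Units.eq_one_of_pow_expChar_pow_eq_one ℓ (k := a) ?_
    rw [← pow_mul, mul_comm, ← map_pow]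
    exact hT _ (hpow τ)
  have : NeZero n := ⟨hn0⟩
  have hle : χ.range ≤ rootsOfUnity n κ := by
    rintro _ ⟨σ, rfl⟩
    exact hχ σ
  have : Finite χ.range := Finite.of_injective _ (Subgroup.inclusion_injective hle)
  obtain ⟨⟨_, σ, rfl⟩, hσ⟩ := IsCyclic.exists_generator (α := χ.range)
  -- Raising a generator of the image of χ to the power ℓ^a still generates, because the image
  -- consists of n-th roots of unity and ℓ is prime to n. It also puts the n-th power into T.
  refine ⟨σ ^ ℓ ^ a, ?_, fun τ => ?_⟩
  · rw [SubmonoidClass.coe_pow, ← pow_mul]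
    exact hpow σ
  · obtain ⟨i, hi⟩ := hσ ⟨χ τ, τ, rfl⟩
    have hi' : χ σ ^ i = χ τ := congrArg Subtype.val hi
    obtain ⟨x, y, hxy⟩ := Nat.isCoprime_iff_coprime.2
      ((Nat.coprime_expChar_of_cast_ne_zero ℓ hn).pow_left a)
    have hx : χ σ ^ (((ℓ ^ a : ℕ) : ℤ) * x) = χ σ := by
      rw [show ((ℓ ^ a : ℕ) : ℤ) * x = 1 - n * y by linear_combination hxy, zpow_sub, zpow_mul,
        zpow_natCast, hχ, one_zpow, zpow_one, inv_one, mul_one]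
    refine ⟨-(x * i), ?_⟩
    rw [map_mul, map_zpow, map_pow, ← hi', zpow_neg, ← zpow_natCast, ← zpow_mul, ← mul_assoc,
      zpow_mul, hx, mul_inv_cancel]

variable (hTρ : T ≤ ρ.ker) (hTI : T ≤ I)
  (htame : ∀ (σ : I) (m : ℕ), (m : K) ≠ 0 → χ σ = 1 → ρ σ ^ m = 1 → ρ σ = 1)
include hTρ htame

omit [ExpChar K ℓ] [ExpChar κ ℓ] in
theorem map_pow_expChar_pow_eq_one {σ : I} (hσ : χ σ = 1) : ρ σ ^ ℓ ^ a = 1 := by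
  rw [← map_pow]
  refine htame (σ ^ ℓ ^ a) n hn (by rw [map_pow, hσ, one_pow]) ?_
  rw [SubmonoidClass.coe_pow, ← map_pow, ← pow_mul]
  exact hTρ (hpow σ)

include hTI in
theorem AffineAlgebraicGroup.map_unipotentClosure_eq [IsAlgClosed K] {V : AffineAlgebraicGroup K G}
    (hT : V.IsTorus T) (hc : T ≤ Subgroup.center G) :
    (V.unipotentClosure I).map ρ = (χ.ker.map I.subtype).map ρ := by
  apply le_antisymm
  · refine Subgroup.map_mono ((Subgroup.closure_le _).2 ?_)
    rintro σ ⟨hσI, hσ⟩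
    refine ⟨⟨σ, hσI⟩, Units.eq_one_of_pow_expChar_pow_eq_one ℓ (k := a) ?_, rfl⟩
    rw [← map_pow, ← χ.map_one]
    exact congrArg χ (Subtype.ext (hσ.pow_expChar_pow_eq_one hT hn (hpow σ)))
  · rintro _ ⟨_, ⟨σ, hσ, rfl⟩, rfl⟩
    have hσρ := map_pow_expChar_pow_eq_one ℓ hn hpow hTρ htame hσ
    obtain ⟨x, y, hxy⟩ := Nat.isCoprime_iff_coprime.2
      ((Nat.coprime_expChar_of_cast_ne_zero ℓ hn).pow_left a)
    -- By Bézout this is the ℓ-part of σ: it acts as σ does, and its ℓ^a-th power lies in T. A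
    -- correction by T then gives it ℓ-power order, hence makes it unipotent.
    let τ : G := σ ^ ((n : ℤ) * y)
    have hτρ : ρ τ = ρ σ := by
      rw [map_zpow, show (n : ℤ) * y = 1 - ((ℓ ^ a : ℕ) : ℤ) * x by linear_combination hxy,
        zpow_sub, zpow_mul, zpow_natCast, hσρ, one_zpow, zpow_one, inv_one, mul_one]
    have hτ : τ ^ ℓ ^ a ∈ T := by
      have : τ ^ ℓ ^ a = ((σ : G) ^ (ℓ ^ a * n)) ^ y := by
        rw [← zpow_natCast, ← zpow_mul, ← zpow_natCast, ← zpow_mul]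
        congr 1
        push_cast
        ring
      rw [this]
      exact T.zpow_mem (hpow σ) y
    obtain ⟨t, ht, h⟩ := V.exists_pow_eq_one_of_pow_mem hT hc (pow_pos (expChar_pos K ℓ) a) hτ
    refine ⟨τ * t, Subgroup.subset_closure ⟨I.mul_mem (I.zpow_mem σ.2 _) (hTI ht),
      isUnipotent_of_pow_expChar_pow_eq_one ℓ h⟩, ?_⟩
    rw [map_mul, hτρ, (hTρ ht : ρ t = 1), mul_one]
    rfl

-- The image of ker χ is a normal ℓ-subgroup, so it lies in every Sylow subgroup. Conversely χ kills
-- elements acting with ℓ-power order, since the residue field has no such roots of unity.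
omit [ExpChar K ℓ] in
theorem mem_sylow_map_iff [Fact ℓ.Prime] (hker : ∀ σ : I, ρ σ = 1 → χ σ = 1)
    (P : Sylow ℓ (I.map ρ)) (σ : I) :
    ρ σ ∈ (P : Subgroup (I.map ρ)).map (Subgroup.subtype _) ↔ χ σ = 1 := by
  let ρ' := ρ.subgroupMap I
  have hM : IsPGroup ℓ (χ.ker.map ρ') := by
    rintro ⟨_, τ, hτ, rfl⟩
    exact ⟨a, Subtype.ext (Subtype.ext (map_pow_expChar_pow_eq_one ℓ hn hpow hTρ htame hτ))⟩
  have : (χ.ker.map ρ').Normal := Subgroup.Normal.map inferInstance _ (ρ.subgroupMap_surjective I)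
  have hMP : χ.ker.map ρ' ≤ P := by
    rw [← P.is_maximal' (P.2.to_sup_of_normal_right hM) le_sup_left]
    exact le_sup_right
  constructor
  · rintro ⟨τ, hτ, h⟩
    obtain ⟨k, hk⟩ := P.2 ⟨τ, hτ⟩
    refine Units.eq_one_of_pow_expChar_pow_eq_one ℓ (k := k) ?_
    rw [← map_pow]
    refine hker _ ?_
    rw [SubmonoidClass.coe_pow, map_pow, ← h]
    exact congrArg (fun z : (P : Subgroup (I.map ρ)) => ((z : I.map ρ) : X)) hk
  · exact fun h => ⟨ρ' σ, hMP ⟨σ, h, rfl⟩, rfl⟩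

end TameCharacter

/-! ### The inertia group and its character. -/

section InertiaCharacter

variable {K : Type*} [Field K] {G : Type*} [Group G] {R : Type*} [CommRing R] [Algebra K R]
  [MulSemiringAction G R] [SMulCommClass G K R] {N : Subgroup G} [N.Normal] [IsDomain R]
  (q : Ideal (invariants K R N)) [q.IsPrime] [IsDiscreteValuationRing (Localization.AtPrime q)]

omit [IsDomain R] in
theorem restrictionHom_eq_one_iff (σ : G) :
    restrictionHom K R N σ = 1 ↔ ∀ x : invariants K R N, (σ : G ⧸ N) • x = x :=
  ⟨fun h x => DFunLike.congr_fun h x, fun h => Equiv.ext h⟩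

theorem exists_inertiaGroup_character : ∃ χ : inertiaGroup q →* q.ResidueFieldˣ,
    (∀ σ : inertiaGroup q, restrictionHom K R N σ = 1 → χ σ = 1) ∧
      ∀ (σ : inertiaGroup q) (m : ℕ), (m : K) ≠ 0 → χ σ = 1 → restrictionHom K R N σ ^ m = 1 →
        restrictionHom K R N σ = 1 := by
  obtain ⟨w, hw⟩ := exists_isOrderAt q
  obtain ⟨π, hπ, hπ1⟩ := hw.exists_eq_one
  let r := algebraMap (invariants K R N) q.ResidueField
  have hr (x : invariants K R N) : r x = 0 ↔ x ∈ q := Ideal.algebraMap_residueField_eq_zero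
  obtain ⟨χ, hχ⟩ := exists_tame_character (Γ := G ⧸ N) hw r hr hπ hπ1
  let φ : inertiaGroup q →* q.inertia (G ⧸ N) :=
    ((QuotientGroup.mk' N).comp (inertiaGroup q).subtype).codRestrict _ fun σ => σ.2
  refine ⟨χ.comp φ, fun σ hσ => ?_, fun σ m hm hσ hσm => ?_⟩
  · have h := hχ (φ σ) 1 1 (by
      rw [one_mul, one_mul]
      exact (restrictionHom_eq_one_iff (σ : G)).1 hσ π)
    rw [map_one, one_mul] at h
    exact Units.ext h
  · have hmq : (m : invariants K R N) ∉ q := by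
      rw [← hr, ← map_natCast (algebraMap K (invariants K R N)), ← RingHom.comp_apply,
        map_eq_zero]
      exact hm
    refine (restrictionHom_eq_one_iff (σ : G)).2
      (smul_eq_of_pow_smul_eq hw r hr hπ hπ1 σ.2 (fun s c h => ?_) hmq fun x => ?_)
    · rw [← hχ (φ σ) s c h, show χ (φ σ) = 1 from hσ, Units.val_one, mul_one]
    · rw [← map_pow] at hσm
      exact (restrictionHom_eq_one_iff ((σ : G) ^ m)).1 hσm x

omit [IsDomain R] [IsDiscreteValuationRing (Localization.AtPrime q)] [q.IsPrime] in
theorem IsInertiaPPart.eq_map_ker {κ : Type*} [Field κ] {p ℓ : ℕ} [ExpChar κ ℓ]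
    (hℓ : p = 0 ∧ ℓ = 1 ∨ p.Prime ∧ ℓ = p) {χ : inertiaGroup q →* κˣ} {a n : ℕ}
    (hn : (n : K) ≠ 0) (hpow : ∀ σ : G, σ ^ (ℓ ^ a * n) ∈ N)
    (hker : ∀ σ : inertiaGroup q, restrictionHom K R N σ = 1 → χ σ = 1)
    (htame : ∀ (σ : inertiaGroup q) (m : ℕ), (m : K) ≠ 0 → χ σ = 1 →
      restrictionHom K R N σ ^ m = 1 → restrictionHom K R N σ = 1)
    {J : Subgroup G} (hJ : IsInertiaPPart p q J) :
    J = χ.ker.map (inertiaGroup q).subtype := by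
  have hN : N ≤ (restrictionHom K R N).ker := fun σ hσ =>
    (restrictionHom_eq_one_iff σ).2 fun x => Subtype.ext (x.2 ⟨σ, hσ⟩)
  suffices ∀ σ : inertiaGroup q, (σ : G) ∈ J ↔ χ σ = 1 by
    ext σ
    constructor
    · intro hσ
      have hσI : σ ∈ inertiaGroup q := by
        rcases hJ with ⟨-, rfl⟩ | ⟨-, P, rfl⟩ <;> exact hσ.1
      exact ⟨⟨σ, hσI⟩, (this ⟨σ, hσI⟩).1 hσ, rfl⟩
    · rintro ⟨τ, hτ, rfl⟩
      exact (this τ).2 hτ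
  intro σ
  rcases hℓ with ⟨rfl, rfl⟩ | ⟨hp, rfl⟩
  · rcases hJ with ⟨-, rfl⟩ | ⟨h, -⟩
    · refine ⟨fun h => hker σ h.2, fun h => ⟨σ.2, ?_⟩⟩
      simpa using map_pow_expChar_pow_eq_one 1 hn hpow hN htame h
    · exact absurd rfl h
  · rcases hJ with ⟨h, -⟩ | ⟨-, P, rfl⟩
    · exact absurd h hp.ne_zero
    · have := Fact.mk hp
      exact ⟨fun h => (mem_sylow_map_iff ℓ hn hpow hN htame hker P σ).1 h.2,
        fun h => ⟨σ.2, (mem_sylow_map_iff ℓ hn hpow hN htame hker P σ).2 h⟩⟩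

/-- Divisibility at the contraction of q can be tested at q itself, where the order is invariant
under inertia. So σ preserves the order downstairs even without acting on all the S-invariants. -/
theorem IsOrderAt.eq_of_coe_eq_smul [N.FiniteIndex] {S : Subgroup G} (hN : N ≤ S)
    (hS : S ≤ inertiaGroup q) {v : invariants K R S → ℕ}
    (hv : IsOrderAt (q.comap (invariantsInclusion K R hN)) v) {σ : G} (hσ : σ ∈ inertiaGroup q)
    {x y : invariants K R S} (hx : x ≠ 0) (h : (y : R) = σ • (x : R)) : v y = v x := by
  obtain ⟨w, hw⟩ := exists_isOrderAt q
  let g := invariantsInclusion K R hN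
  have hg (z : invariants K R S) (hz : z ≠ 0) : g z ≠ 0 := by
    rwa [Ne, map_eq_zero_iff g (invariantsInclusion_injective hN)]
  have hgy : g y = (σ : G ⧸ N) • g x := Subtype.ext h
  have hy : y ≠ 0 := by
    rintro rfl
    rw [map_zero] at hgy
    exact (smul_ne_zero_iff_ne (σ : G ⧸ N)).2 (hg x hx) hgy.symm
  have hwxy : w (g y) = w (g x) := by
    rw [hgy]
    exact hw.smul (smul_mem_iff_of_mem_inertia hσ) (hg x hx)
  apply le_antisymm
  · exact (hv.le_iff y x hy hx).2 (exists_mul_eq_of_le_inertiaGroup q hN hS hy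
      ((hw.le_iff _ _ (hg y hy) (hg x hx)).1 hwxy.le))
  · exact (hv.le_iff x y hx hy).2 (exists_mul_eq_of_le_inertiaGroup q hN hS hx
      ((hw.le_iff _ _ (hg x hx) (hg y hy)).1 hwxy.ge))

/-- The product of the first n translates of a uniformizer under σ is σ-fixed, hence I-invariant,
and has order n. The number n need only annihilate the action of σ; it need not be its exact order.
-/
theorem exists_map_eq_maximalIdeal_pow_invariants [N.FiniteIndex] (hq : q ≠ ⊥) {S : Subgroup G}
    (hN : N ≤ S) (hS : S ≤ inertiaGroup q) {σ : G} (hσ : σ ∈ inertiaGroup q) {n : ℕ}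
    (hσn : ∀ x ∈ invariants K R S, σ ^ n • x = x)
    (hmem : ∀ x ∈ invariants K R S, σ • x ∈ invariants K R S)
    (hfix : ∀ x ∈ invariants K R S, σ • x = x → x ∈ invariants K R (inertiaGroup q)) :
    ∃ e, e ∣ n ∧ ((q.comap (invariantsInclusion K R hN)).comap (invariantsInclusion K R hS)).map
      ((algebraMap _ (Localization.AtPrime (q.comap (invariantsInclusion K R hN)))).comp
        (invariantsInclusion K R hS)) = IsLocalRing.maximalIdeal
          (Localization.AtPrime (q.comap (invariantsInclusion K R hN))) ^ e := by
  have := isDiscreteValuationRing_invariants q hq hN hS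
  have : IsDiscreteValuationRing (Localization.AtPrime
      ((q.comap (invariantsInclusion K R hN)).comap (invariantsInclusion K R hS))) :=
    isDiscreteValuationRing_invariants q hq (hN.trans hS) le_rfl
  obtain ⟨v, hv⟩ := exists_isOrderAt (q.comap (invariantsInclusion K R hN))
  obtain ⟨u, hu, hu1⟩ := hv.exists_eq_one
  have hpow (i : ℕ) : σ ^ i • (u : R) ∈ invariants K R S := by
    induction i with
    | zero => simp
    | succ i ih => rw [pow_succ', mul_smul]; exact hmem _ ih
  let f (i : ℕ) : invariants K R S := ⟨σ ^ i • (u : R), hpow i⟩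
  have hf (i : ℕ) : v (f i) = 1 :=
    (hv.eq_of_coe_eq_smul q hN hS ((inertiaGroup q).pow_mem hσ i) hu rfl).trans hu1
  have hu0 : (u : R) ≠ 0 := fun h => hu (Subtype.ext h)
  have hf0 (i : ℕ) : f i ≠ 0 := fun h =>
    (smul_ne_zero_iff_ne (σ ^ i)).2 hu0 (congrArg Subtype.val h)
  let x := ∏ i ∈ Finset.range n, f i
  have hx0 : x ≠ 0 := Finset.prod_ne_zero_iff.2 fun i _ => hf0 i
  have hvx : v x = n := by
    rw [hv.prod _ _ fun i _ => hf0 i]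
    simp [hf]
  have hx : (x : R) =
      ∏ i ∈ Finset.range n, σ ^ i • (u : R) := by
    rw [← Subalgebra.coe_val, map_prod]
    rfl
  have hσx : σ • (x : R) = x := by
    refine mul_right_cancel₀ hu0 ?_
    rw [hx, Finset.smul_prod']
    have h1 := Finset.prod_range_succ' (fun i => σ ^ i • (u : R)) n
    rw [Finset.prod_range_succ, hσn _ u.2] at h1
    simpa [pow_succ', mul_smul] using h1.symm
  let := (invariantsInclusion K R hS).toAlgebra
  have : FaithfulSMul (invariants K R (inertiaGroup q)) (invariants K R S) :=
    (faithfulSMul_iff_algebraMap_injective _ _).2 (invariantsInclusion_injective hS)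
  obtain ⟨e, he, h⟩ := exists_map_eq_maximalIdeal_pow (q.comap (invariantsInclusion K R hN)) hv
    (x := (⟨x, hfix x x.2 hσx⟩ : invariants K R (inertiaGroup q)))
    (by
      intro h
      have h1 := congrArg Subtype.val h
      exact hx0 (Subtype.ext h1))
  refine ⟨e, ?_, h⟩
  rw [← hvx]
  exact he

end InertiaCharacter

/-! ### The main theorem. -/

theorem mainTheorem4 {K : Type*} [Field K] [IsAlgClosed K] (p : ℕ) [CharP K p]
    {G : Type*} [Group G] (V : AffineAlgebraicGroup K G)
    (htorus : V.IsTorus V.identityComponent)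
    (hcent : Subgroup.centralizer (V.identityComponent : Set G) = ⊤)
    {R : Type*} [CommRing R] [Algebra K R] [MulSemiringAction G R] [SMulCommClass G K R]
    (hR : IsKrullDomain R) (hrational : V.IsRational R)
    (heffective : Finite (MulAction.toPermHom G R).ker)
    (q : Ideal (invariants K R V.identityComponent)) [q.IsPrime] (hq : q.height = 1) :
    (Finite (V.unipotentClosure (inertiaGroup q)) ∧
      ∀ J : Subgroup G, IsInertiaPPart p q J →
        (V.unipotentClosure (inertiaGroup q)).map (restrictionHom K R V.identityComponent) =
            J.map (restrictionHom K R V.identityComponent) ∧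
          invariants K R (V.unipotentClosure (inertiaGroup q) ⊔ V.identityComponent) =
            invariants K R J) ∧
    (∃ D : Subgroup G, V.IsDiagonalizable D ∧ D ≤ inertiaGroup q ∧ V.identityComponent ≤ D ∧
      IsCyclic (D ⧸ V.identityComponent.subgroupOf D) ∧
      invariants K R (V.unipotentClosure (inertiaGroup q) ⊔ D) =
        invariants K R (inertiaGroup q)) ∧
    (let P : Ideal (invariants K R (inertiaGroup q)) :=
        q.comap (invariantsInclusion K R (le_inertiaGroup q))
      let f : invariants K R (⊤ : Subgroup G) →+* invariants K R (inertiaGroup q) :=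
        invariantsInclusion K R le_top
      IsEtaleLocalHom (Localization.localRingHom (P.comap f) P f rfl)) ∧
    (let Q : Ideal (invariants K R
          (V.unipotentClosure (inertiaGroup q) ⊔ V.identityComponent)) :=
        q.comap (invariantsInclusion K R le_sup_right)
      let g : invariants K R (⊤ : Subgroup G) →+*
          invariants K R (V.unipotentClosure (inertiaGroup q) ⊔ V.identityComponent) :=
        invariantsInclusion K R le_top
      Q.height = 1 ∧ (Q.comap g).height = 1 ∧
        (Q.comap g).map ((algebraMap _ (Localization.AtPrime Q)).comp g) =
          IsLocalRing.maximalIdeal (Localization.AtPrime Q) ^ ramificationIndex g Q ∧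
        (p ≠ 0 → ¬ p ∣ ramificationIndex g Q)) := by
  have := hR.toIsDomain
  let T := V.identityComponent
  let I := inertiaGroup q
  let ρ := restrictionHom K R T
  have hc : T ≤ Subgroup.center G := Subgroup.centralizer_eq_top_iff_subset.1 hcent
  have hTI : T ≤ I := le_inertiaGroup q
  have hTρ : T ≤ ρ.ker := fun σ hσ =>
    (restrictionHom_eq_one_iff σ).2 fun x => Subtype.ext (x.2 ⟨σ, hσ⟩)
  have hdvr : IsDiscreteValuationRing (Localization.AtPrime q) :=
    hR.isDiscreteValuationRing_invariants q hq
  have hq0 : q ≠ ⊥ := by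
    rintro rfl
    simp at hq
  -- Working with the exponential characteristic ℓ, equal to 1 when p = 0, treats both cases
  -- uniformly.
  obtain ⟨ℓ, hexp, hℓ⟩ : ∃ ℓ, ExpChar K ℓ ∧ (p = 0 ∧ ℓ = 1 ∨ p.Prime ∧ ℓ = p) := by
    rcases CharP.char_is_prime_or_zero K p with hp | rfl
    · exact ⟨p, .prime hp, Or.inr ⟨hp, rfl⟩⟩
    · have := CharP.charP_to_charZero K
      exact ⟨1, .zero, Or.inl ⟨rfl, rfl⟩⟩
  have : ExpChar q.ResidueField ℓ := expChar_of_injective_algebraMap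
    ((algebraMap (invariants K R T) q.ResidueField).comp (algebraMap K _)).injective ℓ
  obtain ⟨a, n, hidx, hn⟩ := AffineAlgebraicGroup.exists_index_eq_expChar_pow_mul (K := K) ℓ
    (Subgroup.FiniteIndex.index_ne_zero (H := T))
  have hpow (σ : G) : σ ^ (ℓ ^ a * n) ∈ T := hidx ▸ T.pow_index_mem σ
  obtain ⟨χ, hker, htame⟩ := exists_inertiaGroup_character q
  -- The wild inertia group. It will turn out to be I_[p] for every choice of Sylow subgroup, and it
  -- contains T.
  let W := χ.ker.map I.subtype
  have hTW : T ≤ W := fun σ hσ => ⟨⟨σ, hTI hσ⟩, hker _ (hTρ hσ), rfl⟩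
  have hUW : (V.unipotentClosure I).map ρ = W.map ρ :=
    AffineAlgebraicGroup.map_unipotentClosure_eq ℓ hn hpow hTρ hTI htame htorus hc
  have hTmap : T.map ρ = ⊥ := (Subgroup.map_eq_bot_iff _).2 hTρ
  have hUT : (V.unipotentClosure I ⊔ T).map ρ = W.map ρ := by
    rw [Subgroup.map_sup, hUW, hTmap, sup_bot_eq]
  have hinv : invariants K R (V.unipotentClosure I ⊔ T) = invariants K R W :=
    le_antisymm (invariants_le_of_map_le le_sup_right hUT.ge) (invariants_le_of_map_le hTW hUT.le)
  obtain ⟨σ, hσT, hσ⟩ := exists_pow_mem_and_forall_map_mul_zpow_eq_one ℓ hn hpow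
    (χ := χ) fun τ hτ => hker τ (hTρ hτ)
  have hUI : V.unipotentClosure I ≤ I := (Subgroup.closure_le _).2 fun τ hτ => hτ.1
  have hIW (τ : I) : ∃ s ∈ W, ∃ i : ℤ, (τ : G) = s * σ ^ i := by
    obtain ⟨i, hi⟩ := hσ τ
    exact ⟨_, ⟨τ * σ ^ i, hi, rfl⟩, -i, by simp⟩
  have het := isEtaleLocalHom_invariants q
  refine ⟨⟨AffineAlgebraicGroup.finite_unipotentClosure htorus hc _, fun J hJ => ?_⟩, ?_, het, ?_⟩
  · obtain rfl : J = W := hJ.eq_map_ker q hℓ hn hpow hker htame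
    exact ⟨hUW, hinv⟩
  · obtain ⟨D, hD, hTD, hσD, hDT, hcyc⟩ := V.exists_isDiagonalizable htorus hc hn hσT
    have hDI : D ≤ I := hDT.trans (sup_le hTI ((Subgroup.zpowers_le).2 σ.2))
    refine ⟨D, hD, hDI, hTD, hcyc, le_antisymm ?_ (invariants_anti K R (sup_le hUI hDI))⟩
    refine invariants_le_of_map_le (hTD.trans le_sup_right) ?_
    rw [Subgroup.map_sup, hUW, ← Subgroup.map_sup]
    refine Subgroup.map_mono fun τ hτ => ?_
    obtain ⟨s, hs, i, h⟩ := hIW ⟨τ, hτ⟩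
    rw [show τ = s * σ ^ i from h]
    exact Subgroup.mul_mem_sup hs (D.zpow_mem hσD i)
  · intro Q g
    have hS : V.unipotentClosure I ⊔ T ≤ I := sup_le hUI hTI
    have hQ : IsDiscreteValuationRing (Localization.AtPrime Q) :=
      isDiscreteValuationRing_invariants q hq0 le_sup_right hS
    obtain ⟨e, hen, he⟩ := exists_map_eq_maximalIdeal_pow_invariants q hq0
      (le_sup_right : T ≤ V.unipotentClosure I ⊔ T) hS σ.2 (n := n)
      (fun x hx => by
        exact invariants_anti K R le_sup_right hx ⟨_, hσT⟩)
      -- W is the kernel of a character of I, hence normal in I, so σ preserves the W-invariants.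
      (fun x hx => by
        rw [hinv] at hx ⊢
        rintro ⟨_, τ, hτ, rfl⟩
        have hτ' : χ (σ⁻¹ * τ * σ) = 1 := by
          rw [map_mul, map_mul, show χ τ = 1 from hτ, mul_one, ← map_mul, inv_mul_cancel, map_one]
        change (τ : G) • (σ : G) • x = (σ : G) • x
        have h : ((σ : G)⁻¹ * τ * σ) • x = x := hx ⟨_, ⟨_, hτ', rfl⟩⟩
        rw [← mul_smul, ← inv_smul_eq_iff, ← mul_smul, ← mul_assoc, h])
      fun x hx hσx => by
        rw [hinv] at hx
        intro τ
        obtain ⟨s, hs, i, h⟩ := hIW τ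
        change (τ : G) • x = x
        rw [h, mul_smul, (MulAction.stabilizer G x).zpow_mem hσx i]
        exact hx ⟨s, hs⟩
    -- By étaleness over the G-invariants, the index over the I-invariants, already known to divide
    -- n, is the required one.
    have he' : (Q.comap g).map ((algebraMap _ (Localization.AtPrime Q)).comp g) =
        IsLocalRing.maximalIdeal (Localization.AtPrime Q) ^ e :=
      (map_comap_eq_of_isEtaleLocalHom (invariantsInclusion K R (le_top : I ≤ ⊤))
        (invariantsInclusion K R hS) Q het).trans he
    rw [ramificationIndex_eq_of_map_eq g Q he']
    refine ⟨height_comap_invariantsInclusion _ q hq,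
      height_comap_invariantsInclusion le_top q hq, he', fun hp hpe => hn ?_⟩
    exact (CharP.cast_eq_zero_iff K p n).2 (hpe.trans hen)
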